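/- **Setting.** Let $\mathcal X,\mathcal Y,\mathcal I,\mathcal O$ be finite sets, $X$ a random variable on $\mathcal X$, and $X^n$ an i.i.d. sequence of $n$ copies of $X$. Let $d:\mathcal X\times\mathcal Y\to[0,\infty)$, $d^n(x^n,y^n)=\sum_{i=1}^n d(x_i,y_i)$, and let $D$ be a real number. A channel is a sequence $k=(k^n)_n$ of arbitrary transition probabilities $k^n:\mathcal I^n\to\mathcal P(\mathcal O^n)$; a compound channel is a set $\mathcal A$ of channels. Codes are random: at each block length a code is a joint probability distribution on pairs (deterministic encoder, deterministic decoder), independent of everything else, and all probabilities are averaged over it. For $R\ge 0$ let $\mathcal M_R^n=\{1,\dots,2^{\lfloor nR\rfloor}\}$. * A code $(e^n,f^n)_n$, with $e^n:\mathcal X^n\to\mathcal I^n$ and $f^n:\mathcal O^n\to\mathcal Y^n$, *communicates the i.i.d. $X$ source to within distortion $D$ over $\mathcal A$* if there is a sequence $\omega_n\ge0$, $\omega_n\to0$, such that $\Pr\big(\tfrac1n d^n(X^n,Y^n)>D\big)\le\omega_n$ for all $k\in\mathcal A$ and all $n$, where $Y^n$ is the output of $e^n\circ k^n\circ f^n$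 on input $X^n$. * A rate $R$ source code $(e_s^n,f_s^n)_n$, with $e_s^n:\mathcal X^n\to\mathcal M_R^n$ and $f_s^n:\mathcal M_R^n\to\mathcal Y^n$, *codes the source to within distortion $D$* if $\Pr\big(\tfrac1n d^n(X^n,Y^n)>D\big)\to0$, where $Y^n=f_s^n(e_s^n(X^n))$. $R^P_X(D)\in[0,\infty]$ is the infimum of the rates $R\ge0$ of source codes that do so ($\infty$ if there are none). * A rate $R$ channel code $(e_c^n,f_c^n)_n$, with $e_c^n:\mathcal M_R^n\to\mathcal I^n$ and $f_c^n:\mathcal O^n\to\mathcal M_R^n\cup\{\mathrm e\}$ ($\mathrm e$ denotes error), is *reliable over $\mathcal A$* if there is a sequence $\delta_n\ge0$, $\delta_n\to0$, such that for all $k\in\mathcal A$ and all $n$ the error probability of $e_c^n\circ k^n\circ f_c^n$, maximized over the messages $m\in\mathcal M_R^n$, is at most $\delta_n$. * The *separation code* built from a rate $R$ source code and a rate $R$ channel code, drawn independently, has encoder "$e_s^n$, then $e_c^n$" and decoder "$f_c^n$, then $f_s^n$" (a fixed message is substituted when $f_c^n$ outputs $\mathrm e$). **Theorem (Optimality of separation).**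 1. Let $\mathcal A$ be a compound channel and let $(e^n,f^n)_n$ be a code that communicates the i.i.d. $X$ source to within distortion $D$ over $\mathcal A$. Then for every $R\ge0$ with $R<R^P_X(D)$ there is a rate $R$ channel code $(e_c^n,f_c^n)_n$ that is reliable over $\mathcal A$ and uses the same channel resources: for every $n$ and every message $m\in\mathcal M_R^n$, the channel input $e_c^n(m)$ has the same distribution as the channel input $e^n(X^n)$ of the original code. 2. Conversely, let $R>R^P_X(D)$. Then there is a rate $R$ source code, not depending on the compound channel $\mathcal A$ or on the channel code, that codes the i.i.d. $X$ source to within distortion $D$ and is such that, for every compound channel $\mathcal A$ and every rate $R$ channel code reliable over $\mathcal A$, the separation code built from the two communicates the i.i.d. $X$ source to within distortion $D$ over $\mathcal A$; moreover, for every $n$, the channel input of the separation code (with source $X^n$) has the same distribution as the channel input of the channel code when the message is uniformly distributed on $\mathcal M_R^n$. -/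

import Mathlib

open Filter Topology
open scoped NNReal ENNReal

noncomputable section

namespace Separation

/-! ### Channels and random codes -/

/-- A general channel: for each block length `n`, an arbitrary transition probability from
input blocks to output blocks. No causality or consistency between block lengths is imposed.
A compound channel is a `Set (Channel I O)`. -/
abbrev Channel (I O : Type*) := ∀ n : ℕ, (Fin n → I) → PMF (Fin n → O)

/-- A random encoder-decoder: a joint probability distribution on pairs
(deterministic encoder `M → I`, deterministic decoder `O → N`). -/
abbrev RandomCode (M I O N : Type*) := PMF ((M → I) × (O → N))

/-- The transition probability `e ∘ k ∘ f` from `M` to `N`, averaged over the random code. -/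
def endToEnd {M I O N : Type*} (c : RandomCode M I O N) (k : I → PMF O) (m : M) : PMF N :=
  c.bind fun ef => (k (ef.1 m)).map ef.2

/-- The law of the encoder output (the channel input) when the encoder input has law `P` and is
independent of the random code. -/
def inputLaw {M I O N : Type*} (c : RandomCode M I O N) (P : PMF M) : PMF I :=
  P.bind fun m => c.map fun ef => ef.1 m

/-- The joint law of (input, output) for input law `P` and transition probability `W`. -/
def jointLaw {M N : Type*} (P : PMF M) (W : M → PMF N) : PMF (M × N) :=
  P.bind fun m => (W m).map fun y => (m, y)

/-! ### Source and distortion -/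

/-- The law of an i.i.d. sequence of length `n` with marginal `p`. -/
def iid {X : Type*} [Fintype X] (p : PMF X) (n : ℕ) : PMF (Fin n → X) :=
  PMF.ofFintype (fun x => ∏ i, p (x i)) (by
    classical
    have h := Finset.prod_univ_sum (fun _ : Fin n => (Finset.univ : Finset X)) (fun _ a => p a)
    rw [Fintype.piFinset_univ] at h
    rw [← h]
    have h1 : ∑ a, p a = 1 := by rw [← tsum_fintype (L := .unconditional X)]; exact p.tsum_coe
    simp [h1])

/-- The normalized additive distortion `(1/n) ∑ᵢ d(xᵢ, yᵢ)`. -/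
def avgDistortion {X Y : Type*} (d : X → Y → ℝ≥0) {n : ℕ} (x : Fin n → X) (y : Fin n → Y) : ℝ :=
  (∑ i, (d (x i) (y i) : ℝ)) / n

/-- `Pr((1/n) dⁿ(Xⁿ, Yⁿ) > D)`, with `Xⁿ` i.i.d. `p` and `Yⁿ` the output of `W` on input `Xⁿ`. -/
def excessProb {X Y : Type*} [Fintype X] (p : PMF X) (d : X → Y → ℝ≥0) (D : ℝ) (n : ℕ)
    (W : (Fin n → X) → PMF (Fin n → Y)) : ℝ≥0∞ :=
  (jointLaw (iid p n) W).toOuterMeasure {z | D < avgDistortion d z.1 z.2}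

/-! ### End-to-end communication -/

/-- A sequence of random encoder-decoders for sending source blocks over a channel. -/
abbrev JointCode (X Y I O : Type*) :=
  ∀ n : ℕ, RandomCode (Fin n → X) (Fin n → I) (Fin n → O) (Fin n → Y)

/-- The code sequence `c` communicates the i.i.d. `p` source to within distortion `D` over the
compound channel `A`, with a rate of convergence uniform over `A`. -/
def Communicates {X Y I O : Type*} [Fintype X] (A : Set (Channel I O)) (p : PMF X)
    (d : X → Y → ℝ≥0) (D : ℝ) (c : JointCode X Y I O) : Prop :=
  ∃ ω : ℕ → ℝ≥0, Tendsto ω atTop (𝓝 0) ∧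
    ∀ k ∈ A, ∀ n, excessProb p d D n (endToEnd (c n) (k n)) ≤ ω n

/-! ### Source codes and the rate-distortion function -/

/-- The message set with `2 ^ ⌊nR⌋` elements. -/
abbrev Message (R : ℝ≥0) (n : ℕ) := Fin (2 ^ ⌊(n : ℝ≥0) * R⌋₊)

/-- A rate `R` random source code. -/
abbrev SourceCode (R : ℝ≥0) (X Y : Type*) :=
  ∀ n : ℕ, RandomCode (Fin n → X) (Message R n) (Message R n) (Fin n → Y)

/-- The source code `s` codes the i.i.d. `p` source to within distortion `D` (probability of
excess distortion criterion); `PMF.pure` is the noiseless link from encoder to decoder. -/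
def CodesSource {X Y : Type*} [Fintype X] {R : ℝ≥0} (p : PMF X) (d : X → Y → ℝ≥0) (D : ℝ)
    (s : SourceCode R X Y) : Prop :=
  Tendsto (fun n => excessProb p d D n (endToEnd (s n) PMF.pure)) atTop (𝓝 0)

/-- The operational rate-distortion function: the infimum of the rates at which the source can be
coded to within distortion `D`; it is `∞` if there is no such rate. -/
def rateDistortion {X Y : Type*} [Fintype X] (p : PMF X) (d : X → Y → ℝ≥0) (D : ℝ) : ℝ≥0∞ :=
  ⨅ (R : ℝ≥0) (_ : ∃ s : SourceCode R X Y, CodesSource p d D s), (R : ℝ≥0∞)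

/-! ### Channel codes and separation -/

/-- A rate `R` random channel code; the decoder output `none` declares an error. -/
abbrev ChannelCode (R : ℝ≥0) (I O : Type*) :=
  ∀ n : ℕ, RandomCode (Message R n) (Fin n → I) (Fin n → O) (Option (Message R n))

/-- The channel code `c` accomplishes reliable communication over the compound channel `A`: the
maximal error probability tends to `0` uniformly over `A`. -/
def IsReliable {I O : Type*} {R : ℝ≥0} (A : Set (Channel I O)) (c : ChannelCode R I O) : Prop :=
  ∃ δ : ℕ → ℝ≥0, Tendsto δ atTop (𝓝 0) ∧
    ∀ k ∈ A, ∀ n, (⨆ m, (endToEnd (c n) (k n) m).toOuterMeasure {some m}ᶜ) ≤ δ n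

/-- The separation-based code: source encoder followed by channel encoder, channel decoder followed
by source decoder, the source code and the channel code being drawn independently. If the channel
decoder declares an error, the source decoder is applied to the fixed message `0`. -/
def separationCode {X Y I O : Type*} {R : ℝ≥0} (s : SourceCode R X Y) (c : ChannelCode R I O) :
    JointCode X Y I O := fun n =>
  (s n).bind fun es => (c n).map fun ec =>
    (fun x => ec.1 (es.1 x), fun o => es.2 ((ec.2 o).getD 0))

end Separation

end

noncomputable section

namespace Separation

/-! ### Product measures on a finite alphabet -/

/-! Direct half. A code meeting distortion `D` turns any channel into one whose output block is
close to its input block. Represent each message by an independent copy of the source block, feed it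
to the original encoder, and decode to the unique message whose block is typical and within
distortion `D` of the reconstruction `y` (`packingCode`). Each channel input then has the law of the
original one automatically. The transmitted block fails the test only if it is atypical or the
original code fails. A competing block is independent of `y`, so it passes with probability at most
the largest mass of typical blocks within distortion `D` of a fixed `y` (`packingCode_error_le`).
The channel enters only through the guarantee of the original code, so the bound is uniform over the
compound channel.

That mass must beat `2 ^ (nR)` for `R` below the operational rate-distortion function
(`exists_packing_exponent`). The method of types bounds it by `exp (-nρ)` up to a polynomial, `ρ`
being a lower bound on the information of the joint types that occur (`iidProb_le_of_jointInfo_ge`).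
Such a bound holds for joint laws with first marginal `p` because smaller information would give, by
random covering, a source code of too low a rate (`exists_codesSource`). Compactness extends it to
nearby marginals (`exists_marginal_slack`).

Converse half. Start from a source code of rate below `R` and add to its messages a uniform shift
known at both ends (`shiftedCode`). Its performance is unchanged, while its message becomes uniform
given every source block. Composing with a reliable channel code adds at most the maximal message
error (`excessProb_separationCode_le`). -/

theorem sum_prod_apply {Z S : Type*} [Fintype Z] [CommSemiring S] {n : ℕ} (f : Fin n → Z → S) :
    ∑ z : Fin n → Z, ∏ i, f i (z i) = ∏ i, ∑ a, f i a := by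
  classical
  have h := Finset.prod_univ_sum (fun _ : Fin n => (Finset.univ : Finset Z)) f
  rw [Fintype.piFinset_univ] at h
  exact h.symm

theorem prod_apply_nonneg {Z : Type*} {Q : Z → ℝ} {n : ℕ} (hQ : ∀ z, 0 ≤ Q z) (z : Fin n → Z) :
    0 ≤ ∏ i, Q (z i) :=
  Finset.prod_nonneg fun i _ => hQ (z i)

/-- The mass of `s` under the `n`-fold product of the mass function `Q`. -/
def iidProb {Z : Type*} [Fintype Z] (Q : Z → ℝ) (n : ℕ) (s : Set (Fin n → Z)) : ℝ :=
  ∑ z, s.indicator (fun z => ∏ i, Q (z i)) z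

section

variable {Z : Type*} [Fintype Z] {Q : Z → ℝ} {n : ℕ}

theorem iidProb_nonneg (hQ : ∀ z, 0 ≤ Q z) (s : Set (Fin n → Z)) : 0 ≤ iidProb Q n s :=
  Finset.sum_nonneg fun z _ => Set.indicator_nonneg (fun z _ => prod_apply_nonneg hQ z) z

theorem iidProb_mono (hQ : ∀ z, 0 ≤ Q z) {s t : Set (Fin n → Z)} (h : s ⊆ t) :
    iidProb Q n s ≤ iidProb Q n t :=
  Finset.sum_le_sum fun z _ =>
    Set.indicator_le_indicator_of_subset h (fun z => prod_apply_nonneg hQ z) z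

theorem iidProb_univ (h1 : ∑ z, Q z = 1) : iidProb Q n Set.univ = 1 := by
  simp [iidProb, sum_prod_apply (fun _ : Fin n => Q), h1]

theorem iidProb_union_le (hQ : ∀ z, 0 ≤ Q z) (s t : Set (Fin n → Z)) :
    iidProb Q n (s ∪ t) ≤ iidProb Q n s + iidProb Q n t := by
  unfold iidProb
  rw [← Finset.sum_add_distrib]
  refine Finset.sum_le_sum fun z _ => ?_
  have h0 := prod_apply_nonneg hQ z
  by_cases hs : z ∈ s <;> by_cases ht : z ∈ t <;> simp [hs, ht, h0]

theorem iidProb_iUnion_le (hQ : ∀ z, 0 ≤ Q z) {ι : Type*} [Fintype ι] (s : ι → Set (Fin n → Z)) :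
    iidProb Q n (⋃ j, s j) ≤ ∑ j, iidProb Q n (s j) := by
  unfold iidProb
  rw [Finset.sum_comm]
  refine Finset.sum_le_sum fun z _ => ?_
  have h0 := prod_apply_nonneg hQ z
  have hnn : ∀ j ∈ (Finset.univ : Finset ι), 0 ≤ (s j).indicator (fun z => ∏ i, Q (z i)) z :=
    fun j _ => Set.indicator_nonneg (fun z _ => prod_apply_nonneg hQ z) z
  by_cases hz : z ∈ ⋃ j, s j
  · obtain ⟨j, hj⟩ := Set.mem_iUnion.1 hz
    rw [Set.indicator_of_mem hz]
    refine le_trans (le_of_eq ?_) (Finset.single_le_sum hnn (Finset.mem_univ j))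
    rw [Set.indicator_of_mem hj]
  · rw [Set.indicator_of_notMem hz]
    exact Finset.sum_nonneg hnn

theorem iidProb_compl (h1 : ∑ z, Q z = 1) (s : Set (Fin n → Z)) :
    iidProb Q n sᶜ = 1 - iidProb Q n s := by
  rw [eq_sub_iff_add_eq, ← iidProb_univ (n := n) h1]
  unfold iidProb
  rw [← Finset.sum_add_distrib]
  refine Finset.sum_congr rfl fun z _ => ?_
  by_cases hs : z ∈ s <;> simp [hs]

/-- As a function of `t` the sum is `1` at `0`, with derivative the mean of `f - c`, which is
negative. -/
theorem exists_exp_moment_lt_one (h1 : ∑ z, Q z = 1) {f : Z → ℝ} {c : ℝ}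
    (hf : ∑ z, Q z * f z < c) : ∃ t > 0, ∑ z, Q z * Real.exp (t * (f z - c)) < 1 := by
  have hd : HasDerivAt (fun t : ℝ => ∑ z, Q z * Real.exp (t * (f z - c)))
      (∑ z, Q z * (f z - c)) 0 := by
    have h : ∀ z ∈ (Finset.univ : Finset Z),
        HasDerivAt (fun t : ℝ => Q z * Real.exp (t * (f z - c))) (Q z * (f z - c)) 0 := by
      intro z _
      have := (((hasDerivAt_id (0 : ℝ)).mul_const (f z - c)).exp).const_mul (Q z)
      simpa using this
    exact HasDerivAt.fun_sum h
  have hneg : ∑ z, Q z * (f z - c) < 0 := by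
    simp only [mul_sub, Finset.sum_sub_distrib, ← Finset.sum_mul, h1]
    linarith
  have hs := (hasDerivAt_iff_tendsto_slope.1 hd).eventually (gt_mem_nhds hneg)
  have hs' : ∀ᶠ t in 𝓝[>] (0 : ℝ),
      slope (fun t : ℝ => ∑ z, Q z * Real.exp (t * (f z - c))) 0 t < 0 :=
    hs.filter_mono (nhdsWithin_mono _ fun t ht => ne_of_gt ht)
  obtain ⟨t, ht, htpos⟩ := (hs'.and self_mem_nhdsWithin).exists
  refine ⟨t, htpos, ?_⟩
  have htpos' : 0 < t := htpos
  simp only [slope_def_field, zero_mul, Real.exp_zero, mul_one, h1, sub_zero] at ht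
  have := (div_neg_iff.1 ht).resolve_left (fun h => absurd h.2 (not_lt.2 htpos'.le))
  linarith [this.1]

/-- Chernoff's bound: `exp (t * ∑ (f - c))` dominates the indicator of the event and factorizes over
coordinates. -/
theorem iidProb_le_exp_moment_pow (hQ : ∀ z, 0 ≤ Q z) (f : Z → ℝ) (c : ℝ) {t : ℝ} (ht : 0 ≤ t) :
    iidProb Q n {z | n * c < ∑ i, f (z i)} ≤ (∑ z, Q z * Real.exp (t * (f z - c))) ^ n := by
  have h := sum_prod_apply (fun _ : Fin n => fun z => Q z * Real.exp (t * (f z - c)))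
  rw [Finset.prod_const, Finset.card_univ, Fintype.card_fin] at h
  rw [← h]
  refine Finset.sum_le_sum fun z _ => ?_
  have h0 := prod_apply_nonneg hQ z
  rw [Finset.prod_mul_distrib, ← Real.exp_sum, ← Finset.mul_sum, Finset.sum_sub_distrib]
  by_cases hz : (n : ℝ) * c < ∑ i, f (z i)
  · rw [Set.indicator_of_mem (by exact hz)]
    refine le_mul_of_one_le_right h0 (Real.one_le_exp (mul_nonneg ht ?_))
    simp only [Finset.sum_const, Finset.card_univ, Fintype.card_fin, nsmul_eq_mul]
    linarith
  · rw [Set.indicator_of_notMem (by exact hz)]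
    exact mul_nonneg h0 (Real.exp_nonneg _)

/-- The weak law of large numbers, one-sided. -/
theorem tendsto_iidProb_sum_gt (hQ : ∀ z, 0 ≤ Q z) (h1 : ∑ z, Q z = 1) {f : Z → ℝ} {c : ℝ}
    (hf : ∑ z, Q z * f z < c) :
    Tendsto (fun n : ℕ => iidProb Q n {z | n * c < ∑ i, f (z i)}) atTop (𝓝 0) := by
  obtain ⟨t, ht, hlt⟩ := exists_exp_moment_lt_one h1 hf
  have h0 : 0 ≤ ∑ z, Q z * Real.exp (t * (f z - c)) :=
    Finset.sum_nonneg fun z _ => mul_nonneg (hQ z) (Real.exp_nonneg _)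
  exact squeeze_zero (fun n => iidProb_nonneg hQ _)
    (fun n => iidProb_le_exp_moment_pow hQ f c ht.le) (tendsto_pow_atTop_nhds_zero_of_lt_one h0 hlt)

end

/-! ### Joint types and information -/

/-- `D(Q ‖ p × Q_Y)` in nats; the mutual information of `Q` when `p` is its first marginal. -/
def jointInfo {X Y : Type*} [Fintype X] [Fintype Y] (p : X → ℝ) (Q : X × Y → ℝ) : ℝ :=
  ∑ z, Q z * (Real.log (Q z) - Real.log (p z.1) - Real.log (∑ a, Q (a, z.2)))

section

variable {X Y : Type*}

open scoped Classical in
/-- The number of positions at which the pair `(x, y)` takes the value `z`. -/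
def jointCount {n : ℕ} (x : Fin n → X) (y : Fin n → Y) (z : X × Y) : ℕ :=
  (Finset.univ.filter fun i => (x i, y i) = z).card

/-- The empirical distribution of the pair `(x, y)`. -/
def jointType {n : ℕ} (x : Fin n → X) (y : Fin n → Y) (z : X × Y) : ℝ := jointCount x y z / n

theorem jointType_nonneg {n : ℕ} (x : Fin n → X) (y : Fin n → Y) (z : X × Y) :
    0 ≤ jointType x y z := by
  unfold jointType; positivity

theorem jointCount_le {n : ℕ} (x : Fin n → X) (y : Fin n → Y) (z : X × Y) :
    jointCount x y z ≤ n := by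
  classical
  exact (Finset.card_le_univ _).trans (by simp)

theorem jointCount_pos {n : ℕ} (x : Fin n → X) (y : Fin n → Y) (i : Fin n) :
    0 < jointCount x y (x i, y i) := by
  classical
  exact Finset.card_pos.2 ⟨i, by simp⟩

variable [Fintype X] [Fintype Y]

theorem sum_jointCount_mul {n : ℕ} (x : Fin n → X) (y : Fin n → Y) (g : X × Y → ℝ) :
    ∑ z, jointCount x y z * g z = ∑ i, g (x i, y i) := by
  classical
  rw [← Finset.sum_fiberwise Finset.univ (fun i => (x i, y i)) (fun i => g (x i, y i))]
  refine Finset.sum_congr rfl fun z _ => ?_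
  rw [Finset.sum_congr rfl (g := fun _ => g z)]
  · simp [jointCount]
  · intro i hi
    rw [(Finset.mem_filter.1 hi).2]

theorem mul_sum_jointType_mul {n : ℕ} (x : Fin n → X) (y : Fin n → Y) (g : X × Y → ℝ) :
    n * ∑ z, jointType x y z * g z = ∑ i, g (x i, y i) := by
  rcases Nat.eq_zero_or_pos n with rfl | hn
  · simp
  have hn' : (n : ℝ) ≠ 0 := by positivity
  rw [← sum_jointCount_mul, Finset.mul_sum]
  refine Finset.sum_congr rfl fun z _ => ?_
  unfold jointType
  field_simp

theorem sum_jointType {n : ℕ} (hn : 0 < n) (x : Fin n → X) (y : Fin n → Y) :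
    ∑ z, jointType x y z = 1 := by
  have h := mul_sum_jointType_mul x y fun _ => 1
  have hn' : (n : ℝ) ≠ 0 := by positivity
  simp only [mul_one, Finset.sum_const, Finset.card_univ, Fintype.card_fin, nsmul_eq_mul] at h
  exact mul_left_cancel₀ hn' (by rw [h, mul_one])

/-- Change of measure to the empirical backward channel from `y` to `x`: the likelihood ratio
depends on the joint type alone and equals `exp (-n * jointInfo)`. Only the case of zero product
probability makes it an inequality. -/
theorem prod_le_of_jointCount_eq {p : X → ℝ} (hp : ∀ a, 0 ≤ p a) {n : ℕ} {x₀ x : Fin n → X}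
    {y : Fin n → Y} (h : jointCount x y = jointCount x₀ y) :
    ∏ i, p (x i) ≤ Real.exp (-(n * jointInfo p (jointType x₀ y))) *
      ∏ i, (jointType x₀ y (x i, y i) / ∑ a, jointType x₀ y (a, y i)) := by
  have hT : jointType x y = jointType x₀ y := by funext z; simp [jointType, h]
  rw [← hT]
  have hq0 : ∀ b, 0 ≤ ∑ a, jointType x y (a, b) :=
    fun b => Finset.sum_nonneg fun a _ => jointType_nonneg x y _
  rcases eq_or_ne (∏ i, p (x i)) 0 with h0 | h0
  · rw [h0]
    exact mul_nonneg (Real.exp_nonneg _)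
      (Finset.prod_nonneg fun i _ => div_nonneg (jointType_nonneg _ _ _) (hq0 _))
  have hpi : ∀ i, 0 < p (x i) := fun i =>
    (hp _).lt_of_ne' ((Finset.prod_ne_zero_iff.1 h0) i (Finset.mem_univ i))
  have hJ : ∀ i, 0 < jointType x y (x i, y i) := fun i => by
    have h1 := jointCount_pos x y i
    have hn : 0 < n := i.pos
    unfold jointType
    positivity
  have hq : ∀ i, 0 < ∑ a, jointType x y (a, y i) := fun i =>
    (hJ i).trans_le (Finset.single_le_sum (f := fun a => jointType x y (a, y i))
      (fun a _ => jointType_nonneg x y _) (Finset.mem_univ (x i)))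
  unfold jointInfo
  rw [mul_sum_jointType_mul x y (fun z => Real.log (jointType x y z) - Real.log (p z.1)
    - Real.log (∑ a, jointType x y (a, z.2))), ← Finset.sum_neg_distrib, Real.exp_sum,
    ← Finset.prod_mul_distrib]
  refine le_of_eq (Finset.prod_congr rfl fun i _ => ?_)
  have : -(Real.log (jointType x y (x i, y i)) - Real.log (p (x i))
      - Real.log (∑ a, jointType x y (a, y i))) = Real.log (p (x i)) +
      Real.log (∑ a, jointType x y (a, y i)) - Real.log (jointType x y (x i, y i)) := by ring
  simp only [this]
  rw [Real.exp_sub, Real.exp_add, Real.exp_log (hpi i), Real.exp_log (hq i), Real.exp_log (hJ i)]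
  have h1 := (hJ i).ne'
  have h2 := (hq i).ne'
  field_simp

theorem iidProb_jointCount_eq_le {p : X → ℝ} (hp : ∀ a, 0 ≤ p a) {n : ℕ} (x₀ : Fin n → X)
    (y : Fin n → Y) :
    iidProb p n {x | jointCount x y = jointCount x₀ y} ≤
      Real.exp (-(n * jointInfo p (jointType x₀ y))) := by
  have hW : ∀ z : X × Y, 0 ≤ jointType x₀ y z / ∑ a, jointType x₀ y (a, z.2) := fun z =>
    div_nonneg (jointType_nonneg _ _ _) (Finset.sum_nonneg fun a _ => jointType_nonneg _ _ _)
  calc iidProb p n {x | jointCount x y = jointCount x₀ y}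
      ≤ ∑ x : Fin n → X, Real.exp (-(n * jointInfo p (jointType x₀ y))) *
          ∏ i, (jointType x₀ y (x i, y i) / ∑ a, jointType x₀ y (a, y i)) := by
        refine Finset.sum_le_sum fun x _ => ?_
        by_cases hx : jointCount x y = jointCount x₀ y
        · rw [Set.indicator_of_mem (by exact hx)]
          exact prod_le_of_jointCount_eq hp hx
        · rw [Set.indicator_of_notMem (by exact hx)]
          exact mul_nonneg (Real.exp_nonneg _) (Finset.prod_nonneg fun i _ => hW (x i, y i))
    _ ≤ Real.exp (-(n * jointInfo p (jointType x₀ y))) := by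
        rw [← Finset.mul_sum, sum_prod_apply (fun (i : Fin n) (c : X) =>
          jointType x₀ y (c, y i) / ∑ a, jointType x₀ y (a, y i))]
        refine mul_le_of_le_one_right (Real.exp_nonneg _) (Finset.prod_le_one
          (fun i _ => Finset.sum_nonneg fun c _ => hW (c, y i)) fun i _ => ?_)
        rw [← Finset.sum_div]
        exact div_self_le_one _

/-- The method of types: if every joint type arising from `B` has information at least `ρ`, then
`B` has probability at most `exp (-nρ)`, up to a polynomial factor. -/
theorem iidProb_le_of_jointInfo_ge {p : X → ℝ} (hp : ∀ a, 0 ≤ p a) {n : ℕ} (y : Fin n → Y)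
    {B : Set (Fin n → X)} {ρ : ℝ}
    (hB : ∀ x ∈ B, ∏ i, p (x i) ≠ 0 → ρ ≤ jointInfo p (jointType x y)) :
    iidProb p n B ≤ ((n : ℝ) + 1) ^ Fintype.card (X × Y) * Real.exp (-(n * ρ)) := by
  classical
  -- Each count lies in `{0, …, n}`, so the classes number at most `(n + 1) ^ |X × Y|`; this is the
  -- polynomial factor.
  let τ : (Fin n → X) → (X × Y → Fin (n + 1)) := fun x z =>
    ⟨jointCount x y z, Nat.lt_succ_of_le (jointCount_le x y z)⟩
  have hτ : ∀ x x', τ x = τ x' → jointCount x y = jointCount x' y := fun x x' h => by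
    funext z
    exact congrArg Fin.val (congrFun h z)
  have hcov : B ⊆ ⋃ t, {x | x ∈ B ∧ τ x = t} := fun x hx => by simpa using hx
  refine ((iidProb_mono hp hcov).trans (iidProb_iUnion_le hp _)).trans ?_
  have hterm : ∀ t ∈ (Finset.univ : Finset (X × Y → Fin (n + 1))),
      iidProb p n {x | x ∈ B ∧ τ x = t} ≤ Real.exp (-(n * ρ)) := by
    intro t _
    by_cases hex : ∃ x, x ∈ B ∧ τ x = t ∧ ∏ i, p (x i) ≠ 0
    · obtain ⟨x₀, hx₀, rfl, h0⟩ := hex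
      refine (iidProb_mono hp (t := {x | jointCount x y = jointCount x₀ y})
        fun x hx => hτ _ _ hx.2).trans ((iidProb_jointCount_eq_le hp x₀ y).trans ?_)
      have := hB x₀ hx₀ h0
      gcongr
    · refine le_trans (le_of_eq (Finset.sum_eq_zero fun x _ => ?_)) (Real.exp_nonneg _)
      by_contra h
      have hx := Set.mem_of_indicator_ne_zero h
      rw [Set.indicator_of_mem hx] at h
      exact hex ⟨x, hx.1, hx.2, h⟩
  refine (Finset.sum_le_card_nsmul _ _ _ hterm).trans (le_of_eq ?_)
  simp

/-- `t * log t` is continuous at `0`, and the convention `log 0 = 0` keeps the middle term linear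
even where `p` vanishes. Continuity thus holds without domination of the marginal by `p`, as
compactness arguments require. -/
theorem continuous_jointInfo (p : X → ℝ) : Continuous (jointInfo (Y := Y) p) := by
  have h : jointInfo (Y := Y) p = fun Q : X × Y → ℝ =>
      (∑ z, Q z * Real.log (Q z)) - (∑ z, Q z * Real.log (p z.1))
        - ∑ b, (∑ a, Q (a, b)) * Real.log (∑ a, Q (a, b)) := by
    funext Q
    unfold jointInfo
    simp only [mul_sub, Finset.sum_sub_distrib]
    congr 1
    rw [Fintype.sum_prod_type_right]
    exact Finset.sum_congr rfl fun b _ => by rw [Finset.sum_mul]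
  rw [h]
  refine Continuous.sub (Continuous.sub ?_ ?_) ?_
  · exact continuous_finsetSum _ fun z _ => Real.continuous_mul_log.comp (continuous_apply z)
  · exact continuous_finsetSum _ fun z _ => (continuous_apply z).mul continuous_const
  · exact continuous_finsetSum _ fun b _ => Real.continuous_mul_log.comp
      (continuous_finsetSum _ fun a _ => continuous_apply (a, b))

/-- If the information exceeds `ρ` for all joint laws with first marginal `p` and mean cost at most
`D`, it does so for all those whose first marginal is almost dominated by `p`. -/
theorem exists_marginal_slack {p : X → ℝ} (hp1 : ∑ a, p a = 1) (g : X × Y → ℝ) (D ρ : ℝ)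
    (hρ : ∀ Q ∈ stdSimplex ℝ (X × Y), (∀ a, ∑ b, Q (a, b) = p a) → ∑ z, Q z * g z ≤ D →
      ρ < jointInfo p Q) :
    ∃ δ > 0, ∀ Q ∈ stdSimplex ℝ (X × Y), (∀ a, ∑ b, Q (a, b) ≤ p a + δ) → ∑ z, Q z * g z ≤ D →
      ρ < jointInfo p Q := by
  -- `S` collects the violators and `G` measures how far a marginal exceeds `p`. Both marginals have
  -- mass one, so `G = 0` forces equality with `p`, which is excluded on `S`.
  let S : Set (X × Y → ℝ) := stdSimplex ℝ (X × Y) ∩ {Q | ∑ z, Q z * g z ≤ D ∧ jointInfo p Q ≤ ρ}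
  have hS : IsCompact S := by
    refine (isCompact_stdSimplex ℝ (X × Y)).inter_right (IsClosed.inter ?_ ?_)
    · exact isClosed_le (continuous_finsetSum _ fun z _ =>
        (continuous_apply z).mul continuous_const) continuous_const
    · exact isClosed_le (continuous_jointInfo p) continuous_const
  let G : (X × Y → ℝ) → ℝ := fun Q => ∑ a, max (∑ b, Q (a, b) - p a) 0
  have hG : Continuous G := continuous_finsetSum _ fun a _ =>
    ((continuous_finsetSum _ fun b _ => continuous_apply (a, b)).sub continuous_const).max
      continuous_const
  have hpos : ∀ Q ∈ S, 0 < G Q := by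
    rintro Q ⟨hQ, hd, hi⟩
    refine lt_of_le_of_ne (Finset.sum_nonneg fun a _ => le_max_right _ _) fun h0 => ?_
    have hz := (Finset.sum_eq_zero_iff_of_nonneg fun a _ => le_max_right _ _).1 h0.symm
    have hle : ∀ a ∈ (Finset.univ : Finset X), ∑ b, Q (a, b) ≤ p a := fun a ha => by
      have := hz a ha
      have h' := le_max_left (∑ b, Q (a, b) - p a) 0
      linarith
    have hsum : ∑ a, ∑ b, Q (a, b) = ∑ a, p a := by
      rw [hp1, ← Fintype.sum_prod_type]; exact hQ.2
    have heq := (Finset.sum_eq_sum_iff_of_le hle).1 hsum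
    exact absurd (hρ Q hQ (fun a => heq a (Finset.mem_univ a)) hd) (not_lt.2 hi)
  rcases S.eq_empty_or_nonempty with hE | hne
  · refine ⟨1, one_pos, fun Q hQ _ hd => not_le.1 fun hi => ?_⟩
    exact (hE ▸ (⟨hQ, hd, hi⟩ : Q ∈ S) : Q ∈ (∅ : Set _))
  obtain ⟨Q₀, hQ₀, hmin⟩ := hS.exists_isMinOn hne hG.continuousOn
  have h0 := hpos Q₀ hQ₀
  -- With this slack per symbol, the total excess over `|X|` symbols stays strictly below the
  -- minimum of `G` on `S`.
  refine ⟨G Q₀ / (Fintype.card X + 1), by positivity, fun Q hQ hm hd => not_le.1 fun hi => ?_⟩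
  have h1 : G Q₀ ≤ G Q := hmin ⟨hQ, hd, hi⟩
  have h2 : G Q ≤ Fintype.card X * (G Q₀ / (Fintype.card X + 1)) := by
    refine (Finset.sum_le_card_nsmul _ _ (G Q₀ / (Fintype.card X + 1)) fun a _ => ?_).trans
      (by simp)
    refine max_le ?_ (by positivity)
    have := hm a
    linarith
  have h3 : (Fintype.card X : ℝ) * (G Q₀ / (Fintype.card X + 1)) < G Q₀ := by
    rw [← mul_div_assoc, div_lt_iff₀ (by positivity)]
    nlinarith
  linarith

end

/-! ### Random covering -/

section

variable {X Y : Type*} [Fintype X] [Fintype Y]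

theorem iidProb_prod (Q : X × Y → ℝ) (n : ℕ) (s : Set ((Fin n → X) × (Fin n → Y))) :
    iidProb Q n {z | (fun i => (z i).1, fun i => (z i).2) ∈ s} =
      ∑ x, ∑ y, s.indicator (fun w => ∏ i, Q (w.1 i, w.2 i)) (x, y) := by
  rw [← Fintype.sum_prod_type, iidProb]
  refine Fintype.sum_equiv (Equiv.arrowProdEquivProdArrow (Fin n) (fun _ => X) (fun _ => Y)) _ _
    fun z => ?_
  by_cases hz : (fun i => (z i).1, fun i => (z i).2) ∈ s
  · rw [Set.indicator_of_mem (by exact hz), Set.indicator_of_mem (by exact hz)]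
    rfl
  · rw [Set.indicator_of_notMem (by exact hz), Set.indicator_of_notMem (by exact hz)]

/-- Convexity of `exp` on the segment from `-b` to `0`. It separates the conditional failure
probability `1 - a` from the effect `exp (-b)` of a finite codebook. -/
theorem exp_neg_mul_le {a b : ℝ} (h0 : 0 ≤ a) (h1 : a ≤ 1) :
    Real.exp (-(b * a)) ≤ 1 - a + Real.exp (-b) := by
  have h := convexOn_exp.2 (Set.mem_univ 0) (Set.mem_univ (-b)) (sub_nonneg.2 h1) h0
    (sub_add_cancel 1 a)
  simp only [smul_eq_mul, mul_zero, zero_add, Real.exp_zero, mul_one] at h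
  rw [show -(b * a) = a * -b by ring]
  have := mul_le_of_le_one_left (Real.exp_nonneg (-b)) h1
  linarith

/-- If `M` codewords are drawn independently from the product of the second marginal of `Q`, the
probability that all of them are bad for a sequence drawn from the first marginal is controlled by
the information density of `Q`. -/
theorem random_covering_bound {p : X → ℝ} {Q : X × Y → ℝ} (hQ : Q ∈ stdSimplex ℝ (X × Y))
    (hp : ∀ a, ∑ b, Q (a, b) = p a) (n M : ℕ) (ρ : ℝ) (bad : Set ((Fin n → X) × (Fin n → Y))) :
    ∑ x : Fin n → X, (∏ i, p (x i)) *
        iidProb (fun b => ∑ a, Q (a, b)) n {y | (x, y) ∈ bad} ^ M ≤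
      iidProb Q n {z | (fun i => (z i).1, fun i => (z i).2) ∈ bad} +
      iidProb Q n {z | n * ρ < ∑ i, (Real.log (Q (z i)) - Real.log (p (z i).1) -
        Real.log (∑ a, Q (a, (z i).2)))} + Real.exp (-(M * Real.exp (-(n * ρ)))) := by
  classical
  set q : Y → ℝ := fun b => ∑ a, Q (a, b) with hq
  have hQ0 : ∀ z, 0 ≤ Q z := hQ.1
  have hq0 : ∀ b, 0 ≤ q b := fun b => Finset.sum_nonneg fun a _ => hQ0 _
  have hp0 : ∀ a, 0 ≤ p a := fun a => hp a ▸ Finset.sum_nonneg fun b _ => hQ0 _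
  have hq1 : ∑ b, q b = 1 := by
    rw [hq, ← Fintype.sum_prod_type_right]; exact hQ.2
  have hp1 : ∑ a, p a = 1 := by
    simp_rw [← hp]; rw [← Fintype.sum_prod_type]; exact hQ.2
  let dense : Set ((Fin n → X) × (Fin n → Y)) := {w | n * ρ < ∑ i, (Real.log (Q (w.1 i, w.2 i)) -
    Real.log (p (w.1 i)) - Real.log (q (w.2 i)))}
  let E : Set ((Fin n → X) × (Fin n → Y)) := bad ∪ dense
  let J : (Fin n → X) × (Fin n → Y) → ℝ := fun w => ∏ i, Q (w.1 i, w.2 i)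
  have hJ0 : ∀ w, 0 ≤ J w := fun w => Finset.prod_nonneg fun i _ => hQ0 _
  have hJsum : ∀ x : Fin n → X, ∑ y, J (x, y) = ∏ i, p (x i) := fun x => by
    rw [sum_prod_apply (fun (i : Fin n) b => Q (x i, b))]
    exact Finset.prod_congr rfl fun i _ => hp _
  have hterm : ∀ x : Fin n → X, (∏ i, p (x i)) * iidProb q n {y | (x, y) ∈ bad} ^ M ≤
      (∑ y, E.indicator J (x, y)) + (∏ i, p (x i)) * Real.exp (-(M * Real.exp (-(n * ρ)))) := by
    intro x
    have hP0 : 0 ≤ ∏ i, p (x i) := prod_apply_nonneg hp0 x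
    have hE0 : 0 ≤ ∑ y, E.indicator J (x, y) :=
      Finset.sum_nonneg fun y _ => Set.indicator_nonneg (fun w _ => hJ0 w) _
    rcases hP0.eq_or_lt with h0 | hpos
    · rw [← h0]; simpa using hE0
    set P := ∏ i, p (x i) with hP
    have hpi : ∀ i, 0 < p (x i) := fun i =>
      (hp0 _).lt_of_ne' ((Finset.prod_ne_zero_iff.1 hpos.ne') i (Finset.mem_univ i))
    -- `a` is the conditional probability under `Q`, given `x`, that `y` is neither bad nor of
    -- excessive information density. Off `dense`, passing from this conditional law to the product
    -- of `q` costs at most `exp (n * ρ)`, which bounds below the chance that one codeword is not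
    -- bad.
    set a := (∑ y, Eᶜ.indicator J (x, y)) / P with ha
    have hsplit : ∑ y, Eᶜ.indicator J (x, y) = P - ∑ y, E.indicator J (x, y) := by
      rw [eq_sub_iff_add_eq, ← Finset.sum_add_distrib, hP, ← hJsum x]
      exact Finset.sum_congr rfl fun y _ => by
        by_cases h : (x, y) ∈ E <;> simp [h]
    have haP : P * a = P - ∑ y, E.indicator J (x, y) := by
      rw [ha, mul_div_cancel₀ _ hpos.ne', hsplit]
    have ha0 : 0 ≤ a := div_nonneg
      (Finset.sum_nonneg fun y _ => Set.indicator_nonneg (fun w _ => hJ0 w) _) hP0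
    have ha1 : a ≤ 1 := by rw [ha, div_le_one hpos, hsplit]; linarith
    have hπ : Real.exp (-(n * ρ)) * a ≤ iidProb q n {y | (x, y) ∈ bad}ᶜ := by
      rw [ha, Finset.sum_div, Finset.mul_sum]
      refine Finset.sum_le_sum fun y _ => ?_
      by_cases hy : (x, y) ∈ E
      · rw [Set.indicator_of_notMem (by simpa using hy)]
        simpa using Set.indicator_nonneg (fun y _ => prod_apply_nonneg hq0 y) y
      · have hyb : (x, y) ∉ bad := fun h => hy (Or.inl h)
        have hyd : (x, y) ∉ dense := fun h => hy (Or.inr h)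
        rw [Set.indicator_of_mem (by exact hy), Set.indicator_of_mem (by exact hyb)]
        rcases (hJ0 (x, y)).eq_or_lt with h | h
        · rw [← h]; simpa using prod_apply_nonneg hq0 y
        have hQi : ∀ i, 0 < Q (x i, y i) := fun i =>
          (hQ0 _).lt_of_ne' ((Finset.prod_ne_zero_iff.1 h.ne') i (Finset.mem_univ i))
        have hqi : ∀ i, 0 < q (y i) := fun i => (hQi i).trans_le
          (Finset.single_le_sum (f := fun a => Q (a, y i)) (fun a _ => hQ0 _) (Finset.mem_univ _))
        have hJe : J (x, y) = Real.exp (∑ i, (Real.log (Q (x i, y i)) - Real.log (p (x i)) -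
            Real.log (q (y i)))) * (P * ∏ i, q (y i)) := by
          rw [Real.exp_sum, hP, ← Finset.prod_mul_distrib, ← Finset.prod_mul_distrib]
          refine Finset.prod_congr rfl fun i _ => ?_
          rw [Real.exp_sub, Real.exp_sub, Real.exp_log (hQi i), Real.exp_log (hpi i),
            Real.exp_log (hqi i)]
          have h1 := (hpi i).ne'
          have h2 := (hqi i).ne'
          field_simp
        have hle : J (x, y) ≤ Real.exp (n * ρ) * (P * ∏ i, q (y i)) := by
          rw [hJe]
          have hqP : 0 ≤ P * ∏ i, q (y i) := mul_nonneg hP0 (prod_apply_nonneg hq0 y)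
          exact mul_le_mul_of_nonneg_right (Real.exp_le_exp.2 (not_lt.1 hyd)) hqP
        calc Real.exp (-(n * ρ)) * (J (x, y) / P)
            ≤ Real.exp (-(n * ρ)) * (Real.exp (n * ρ) * (P * ∏ i, q (y i)) / P) := by gcongr
          _ = ∏ i, q (y i) := by
            rw [Real.exp_neg]
            have := (Real.exp_pos (n * ρ)).ne'
            field_simp
    have hf : iidProb q n {y | (x, y) ∈ bad} ^ M ≤
        1 - a + Real.exp (-(M * Real.exp (-(n * ρ)))) := by
      rw [iidProb_compl hq1] at hπ
      have h1 : iidProb q n {y | (x, y) ∈ bad} ≤ Real.exp (-(Real.exp (-(n * ρ)) * a)) := by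
        have := Real.add_one_le_exp (-(Real.exp (-(n * ρ)) * a))
        linarith
      calc iidProb q n {y | (x, y) ∈ bad} ^ M
          ≤ Real.exp (-(Real.exp (-(n * ρ)) * a)) ^ M := pow_le_pow_left₀ (iidProb_nonneg hq0 _) h1 M
        _ = Real.exp (-(M * Real.exp (-(n * ρ)) * a)) := by
          rw [← Real.exp_nat_mul]; congr 1; ring
        _ ≤ _ := exp_neg_mul_le ha0 ha1
    calc P * iidProb q n {y | (x, y) ∈ bad} ^ M
        ≤ P * (1 - a + Real.exp (-(M * Real.exp (-(n * ρ))))) := by gcongr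
      _ = _ := by linear_combination -haP
  refine (Finset.sum_le_sum fun x _ => hterm x).trans ?_
  rw [Finset.sum_add_distrib, ← Finset.sum_mul, sum_prod_apply (fun _ : Fin n => p)]
  simp only [hp1, Finset.prod_const_one, one_mul]
  gcongr
  rw [← iidProb_prod Q n E]
  exact iidProb_union_le hQ0 _ _

/-! ### Product laws -/

theorem toOuterMeasure_bind_fintype {U V : Type*} [Fintype U] (P : PMF U) (W : U → PMF V)
    (s : Set V) : (P.bind W).toOuterMeasure s = ∑ u, P u * (W u).toOuterMeasure s := by
  rw [PMF.toOuterMeasure_bind_apply, tsum_fintype]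

theorem iid_apply (p : PMF X) (n : ℕ) (x : Fin n → X) : iid p n x = ∏ i, p (x i) := rfl

theorem iid_toOuterMeasure_pi (p : PMF X) (n : ℕ) (s : Fin n → Set X) :
    (iid p n).toOuterMeasure {x | ∀ i, x i ∈ s i} = ∏ i, p.toOuterMeasure (s i) := by
  classical
  simp_rw [PMF.toOuterMeasure_apply_fintype]
  rw [← sum_prod_apply (fun i => (s i).indicator p)]
  refine Finset.sum_congr rfl fun x _ => ?_
  by_cases h : ∀ i, x i ∈ s i
  · rw [Set.indicator_of_mem (by exact h), iid_apply]
    exact Finset.prod_congr rfl fun i _ => by rw [Set.indicator_of_mem (h i)]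
  · rw [Set.indicator_of_notMem (by exact h)]
    obtain ⟨i, hi⟩ := not_forall.1 h
    exact (Finset.prod_eq_zero (Finset.mem_univ i) (Set.indicator_of_notMem hi _)).symm

theorem sum_toReal (p : PMF X) : ∑ a, (p a).toReal = 1 := by
  rw [← ENNReal.toReal_sum fun a _ => p.apply_ne_top a, ← tsum_fintype (L := .unconditional X),
    p.tsum_coe, ENNReal.toReal_one]

theorem iid_apply_eq_ofReal (p : PMF X) (n : ℕ) (x : Fin n → X) :
    iid p n x = ENNReal.ofReal (∏ i, (p (x i)).toReal) := by
  rw [iid_apply, ENNReal.ofReal_prod_of_nonneg fun i _ => ENNReal.toReal_nonneg]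
  exact Finset.prod_congr rfl fun i _ => (ENNReal.ofReal_toReal (p.apply_ne_top _)).symm

theorem iid_toOuterMeasure (p : PMF X) (n : ℕ) (s : Set (Fin n → X)) :
    (iid p n).toOuterMeasure s = ENNReal.ofReal (iidProb (fun a => (p a).toReal) n s) := by
  rw [PMF.toOuterMeasure_apply_fintype, iidProb, ENNReal.ofReal_sum_of_nonneg fun x _ =>
    Set.indicator_nonneg (fun x _ => prod_apply_nonneg (fun _ => ENNReal.toReal_nonneg) x) x]
  refine Finset.sum_congr rfl fun x _ => ?_
  by_cases h : x ∈ s <;> simp [h, iid_apply_eq_ofReal]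

theorem excessProb_eq_sum {X Y : Type*} [Fintype X] (p : PMF X) (d : X → Y → ℝ≥0) (D : ℝ) (n : ℕ)
    (W : (Fin n → X) → PMF (Fin n → Y)) :
    excessProb p d D n W =
      ∑ x, iid p n x * (W x).toOuterMeasure {y | D < avgDistortion d x y} := by
  rw [excessProb, jointLaw, toOuterMeasure_bind_fintype]
  refine Finset.sum_congr rfl fun x _ => ?_
  rw [PMF.toOuterMeasure_map_apply]
  rfl

theorem lt_avgDistortion_iff {X Y : Type*} (d : X → Y → ℝ≥0) (D : ℝ) {n : ℕ} (hn : 0 < n)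
    (x : Fin n → X) (y : Fin n → Y) : D < avgDistortion d x y ↔ n * D < ∑ i, (d (x i) (y i) : ℝ) := by
  rw [avgDistortion, lt_div_iff₀ (by positivity), mul_comm]

/-! ### Achievability of source coding -/

open scoped Classical in
/-- The random code with `M` codewords drawn independently from `q`; the encoder picks a codeword
that is not bad for its input, if there is one. -/
def coveringCode {U V : Type*} [Fintype V] (q : PMF V) (M : ℕ) [NeZero M] (bad : U → Set V) :
    RandomCode U (Fin M) (Fin M) V :=
  (iid q M).map fun C => (fun x => if h : ∃ m, C m ∉ bad x then h.choose else 0, C)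

/-- The output is bad exactly when all `M` independent codewords are bad; otherwise the encoder
selects one that is not. -/
theorem coveringCode_bad {U V : Type*} [Fintype V] (q : PMF V) (M : ℕ) [NeZero M]
    (bad : U → Set V) (x : U) :
    (endToEnd (coveringCode q M bad) PMF.pure x).toOuterMeasure (bad x) =
      q.toOuterMeasure (bad x) ^ M := by
  classical
  have h := iid_toOuterMeasure_pi q M fun _ => bad x
  rw [Finset.prod_const, Finset.card_univ, Fintype.card_fin] at h
  rw [← h, endToEnd, coveringCode, PMF.bind_map]
  simp only [Function.comp_def, PMF.pure_map]
  rw [← Function.comp_def, PMF.bind_pure_comp, PMF.toOuterMeasure_map_apply]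
  congr 1
  ext C
  simp only [Set.mem_preimage, Set.mem_ofPred_eq]
  split_ifs with hC
  · exact ⟨fun h => absurd h hC.choose_spec, fun h => absurd (h _) hC.choose_spec⟩
  · push Not at hC
    exact ⟨fun _ => hC, fun _ => hC 0⟩

/-- The factor `1 / 2` pays for the fraction of a bit lost to the floor. -/
theorem le_two_pow_floor (R : ℝ≥0) (n : ℕ) :
    Real.exp (n * (R * Real.log 2)) / 2 ≤ ((2 ^ ⌊(n : ℝ≥0) * R⌋₊ : ℕ) : ℝ) := by
  have h : (n : ℝ) * R < ⌊(n : ℝ≥0) * R⌋₊ + 1 := by exact_mod_cast Nat.lt_floor_add_one ((n : ℝ≥0) * R)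
  rw [div_le_iff₀ two_pos, Nat.cast_pow, Nat.cast_ofNat, ← pow_succ,
    ← Real.exp_log (show (0 : ℝ) < 2 ^ (⌊(n : ℝ≥0) * R⌋₊ + 1) by positivity), Real.exp_le_exp,
    Real.log_pow, ← mul_assoc]
  push_cast
  exact mul_le_mul_of_nonneg_right h.le (Real.log_nonneg one_le_two)

theorem two_pow_floor_le (R : ℝ≥0) (n : ℕ) :
    ((2 ^ ⌊(n : ℝ≥0) * R⌋₊ : ℕ) : ℝ) ≤ Real.exp (n * (R * Real.log 2)) := by
  have h : (⌊(n : ℝ≥0) * R⌋₊ : ℝ) ≤ n * R := by exact_mod_cast Nat.floor_le (zero_le (a := (n : ℝ≥0) * R))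
  rw [Nat.cast_pow, Nat.cast_ofNat, ← Real.exp_log (show (0 : ℝ) < 2 ^ ⌊(n : ℝ≥0) * R⌋₊ by positivity),
    Real.exp_le_exp, Real.log_pow, ← mul_assoc]
  exact mul_le_mul_of_nonneg_right h (Real.log_nonneg one_le_two)

/-- Random coding with codewords from the second marginal of `Q`. The distortion hypothesis is a
vanishing tail rather than a mean below `D`, so that the boundary case, out of reach of the law of
large numbers, is covered too. -/
theorem exists_codesSource (p : PMF X) (d : X → Y → ℝ≥0) (D : ℝ) (R : ℝ≥0) {Q : X × Y → ℝ}
    (hQ : Q ∈ stdSimplex ℝ (X × Y)) (hp : ∀ a, ∑ b, Q (a, b) = (p a).toReal)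
    (hd : Tendsto (fun n : ℕ => iidProb Q n {z | n * D < ∑ i, (d (z i).1 (z i).2 : ℝ)}) atTop (𝓝 0))
    (hI : jointInfo (fun a => (p a).toReal) Q < R * Real.log 2) :
    ∃ s : SourceCode R X Y, CodesSource p d D s := by
  -- `ρ` above the information makes the high-density event vanish; `ρ` below `R * log 2` makes the
  -- codebook size times `exp (-nρ)` diverge.
  obtain ⟨ρ, hIρ, hρR⟩ := exists_between hI
  have hq0 : ∀ b, 0 ≤ ∑ a, Q (a, b) := fun b => Finset.sum_nonneg fun a _ => hQ.1 _
  let q : PMF Y := PMF.ofFintype (fun b => ENNReal.ofReal (∑ a, Q (a, b))) (by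
    rw [← ENNReal.ofReal_sum_of_nonneg fun b _ => hq0 b, ← Fintype.sum_prod_type_right,
      show ∑ z, Q z = 1 from hQ.2, ENNReal.ofReal_one])
  have hq : (fun b => (q b).toReal) = fun b => ∑ a, Q (a, b) := by
    funext b
    exact ENNReal.toReal_ofReal (hq0 b)
  refine ⟨fun n => coveringCode (iid q n) _ fun x => {y | D < avgDistortion d x y}, ?_⟩
  let f : X × Y → ℝ := fun z =>
    Real.log (Q z) - Real.log (p z.1).toReal - Real.log (∑ a, Q (a, z.2))
  let b : ℕ → ℝ := fun n => iidProb Q n {z | n * D < ∑ i, (d (z i).1 (z i).2 : ℝ)} +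
    iidProb Q n {z | n * ρ < ∑ i, f (z i)} +
      Real.exp (-(Real.exp (n * (R * Real.log 2 - ρ)) / 2))
  have hexp : Tendsto (fun n : ℕ => Real.exp (-(Real.exp (n * (R * Real.log 2 - ρ)) / 2))) atTop
      (𝓝 0) := by
    refine Real.tendsto_exp_neg_atTop_nhds_zero.comp ((Real.tendsto_exp_atTop.comp ?_).atTop_div_const
      two_pos)
    exact tendsto_natCast_atTop_atTop.atTop_mul_const (sub_pos.2 hρR)
  have hb : Tendsto b atTop (𝓝 0) := by
    have h2 := tendsto_iidProb_sum_gt hQ.1 hQ.2 (f := f) (c := ρ) hIρ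
    simpa using (hd.add h2).add hexp
  have hb' : Tendsto (fun n => ENNReal.ofReal (b n)) atTop (𝓝 0) := by
    simpa using ENNReal.tendsto_ofReal hb
  refine tendsto_of_tendsto_of_tendsto_of_le_of_le' tendsto_const_nhds hb'
    (Eventually.of_forall fun _ => zero_le) ?_
  filter_upwards [eventually_gt_atTop 0] with n hn
  rw [excessProb_eq_sum]
  simp_rw [coveringCode_bad, iid_toOuterMeasure, iid_apply_eq_ofReal, hq]
  have hP0 : ∀ x : Fin n → X, 0 ≤ ∏ i, (p (x i)).toReal :=
    prod_apply_nonneg (Q := fun a => (p a).toReal) fun _ => ENNReal.toReal_nonneg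
  simp_rw [← ENNReal.ofReal_pow (iidProb_nonneg hq0 _), ← ENNReal.ofReal_mul (hP0 _)]
  rw [← ENNReal.ofReal_sum_of_nonneg fun x _ =>
    mul_nonneg (hP0 x) (pow_nonneg (iidProb_nonneg hq0 _) _)]
  refine ENNReal.ofReal_le_ofReal ((random_covering_bound hQ hp n _ ρ
    {w | D < avgDistortion d w.1 w.2}).trans ?_)
  simp only [Set.mem_ofPred_eq, lt_avgDistortion_iff d D hn]
  refine add_le_add le_rfl (Real.exp_le_exp.2 (neg_le_neg ?_))
  rw [mul_sub, Real.exp_sub, div_right_comm, div_eq_mul_inv _ (Real.exp (n * ρ)), ← Real.exp_neg]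
  exact mul_le_mul_of_nonneg_right (le_two_pow_floor R n) (Real.exp_nonneg _)

end

/-! ### Rate-distortion lower bound on information -/

section

variable {X Y : Type*} [Fintype X] [Fintype Y]

theorem iidProb_fst {p : X → ℝ} {Q : X × Y → ℝ} (hp : ∀ a, ∑ b, Q (a, b) = p a) (n : ℕ)
    (s : Set (Fin n → X)) : iidProb Q n {z | (fun i => (z i).1) ∈ s} = iidProb p n s := by
  have h := iidProb_prod Q n {w | w.1 ∈ s}
  simp only [Set.mem_ofPred_eq] at h
  rw [h, iidProb]
  refine Finset.sum_congr rfl fun x _ => ?_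
  by_cases hx : x ∈ s
  · rw [Set.indicator_of_mem hx, Finset.prod_congr rfl fun i _ => (hp (x i)).symm,
      ← sum_prod_apply (fun (i : Fin n) b => Q (x i, b))]
    exact Finset.sum_congr rfl fun y _ => Set.indicator_of_mem (by exact hx) _
  · rw [Set.indicator_of_notMem hx]
    exact Finset.sum_eq_zero fun y _ => Set.indicator_of_notMem (by exact hx) _

/-- Mean distortion exactly `D` does not by itself make the excess probability vanish. If the least
possible mean is below `D`, mixing in a little of the optimal law makes the inequality strict and,
by continuity, keeps the information small. Otherwise `Q` itself attains the least distortion almost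
surely, and `hfeas` controls the tail. -/
theorem exists_codesSource_of_mean_le (p : PMF X) (d : X → Y → ℝ≥0) (D : ℝ) (R : ℝ≥0)
    {h : X → Y} (hmin : ∀ a b, d a (h a) ≤ d a b)
    (hfeas : Tendsto (fun n : ℕ => iidProb (fun a => (p a).toReal) n
      {x | n * D < ∑ i, (d (x i) (h (x i)) : ℝ)}) atTop (𝓝 0))
    {Q : X × Y → ℝ} (hQ : Q ∈ stdSimplex ℝ (X × Y)) (hp : ∀ a, ∑ b, Q (a, b) = (p a).toReal)
    (hd : ∑ z, Q z * (d z.1 z.2 : ℝ) ≤ D)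
    (hI : jointInfo (fun a => (p a).toReal) Q < R * Real.log 2) :
    ∃ s : SourceCode R X Y, CodesSource p d D s := by
  classical
  rcases lt_or_ge (∑ a, (p a).toReal * (d a (h a) : ℝ)) D with hlt | hge
  -- `H` is the joint law of the source symbol and its best reconstruction.
  · let H : X × Y → ℝ := fun z => if z.2 = h z.1 then (p z.1).toReal else 0
    have hHm : ∀ a, ∑ b, H (a, b) = (p a).toReal := fun a => by simp [H]
    have hH : H ∈ stdSimplex ℝ (X × Y) := by
      refine ⟨fun z => ?_, ?_⟩
      · dsimp only [H]; split_ifs <;> simp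
      · rw [Fintype.sum_prod_type, Finset.sum_congr rfl fun a _ => hHm a, sum_toReal]
    have hHd : ∑ z, H z * (d z.1 z.2 : ℝ) = ∑ a, (p a).toReal * (d a (h a) : ℝ) := by
      rw [Fintype.sum_prod_type]
      exact Finset.sum_congr rfl fun a _ => by simp [H, ite_mul]
    let mix : ℝ → X × Y → ℝ := fun t => (1 - t) • Q + t • H
    have hcont : Continuous fun t => jointInfo (fun a => (p a).toReal) (mix t) :=
      (continuous_jointInfo _).comp (by fun_prop)
    have hev : ∀ᶠ t in 𝓝[>] (0 : ℝ), jointInfo (fun a => (p a).toReal) (mix t) < R * Real.log 2 :=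
      (hcont.tendsto 0).eventually (gt_mem_nhds (by simpa [mix] using hI)) |>.filter_mono
        nhdsWithin_le_nhds
    have hev1 : ∀ᶠ t in 𝓝[>] (0 : ℝ), t < 1 :=
      (gt_mem_nhds one_pos : ∀ᶠ t in 𝓝 (0 : ℝ), t < 1).filter_mono nhdsWithin_le_nhds
    obtain ⟨t, ⟨htI, ht1⟩, ht0⟩ := ((hev.and hev1).and self_mem_nhdsWithin).exists
    have ht0' : 0 < t := ht0
    have hmix : mix t ∈ stdSimplex ℝ (X × Y) :=
      convex_stdSimplex ℝ (X × Y) hQ hH (by linarith) ht0'.le (by ring)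
    refine exists_codesSource p d D R hmix (fun a => ?_)
      (tendsto_iidProb_sum_gt hmix.1 hmix.2 (f := fun z => (d z.1 z.2 : ℝ)) ?_) htI
    · simp only [mix, Pi.add_apply, Pi.smul_apply, smul_eq_mul, Finset.sum_add_distrib,
        ← Finset.mul_sum, hp, hHm]
      ring
    · simp only [mix, Pi.add_apply, Pi.smul_apply, smul_eq_mul, add_mul, Finset.sum_add_distrib,
        mul_assoc, ← Finset.mul_sum, hHd]
      nlinarith
  · have hle : ∀ z ∈ (Finset.univ : Finset (X × Y)),
        Q z * (d z.1 (h z.1) : ℝ) ≤ Q z * (d z.1 z.2 : ℝ) := fun z _ =>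
      mul_le_mul_of_nonneg_left (by exact_mod_cast hmin z.1 z.2) (hQ.1 z)
    have hsum : ∑ z, Q z * (d z.1 (h z.1) : ℝ) = ∑ a, (p a).toReal * (d a (h a) : ℝ) := by
      rw [Fintype.sum_prod_type]
      exact Finset.sum_congr rfl fun a _ => by rw [← hp, Finset.sum_mul]
    -- Both means are squeezed to `D`, so `Q` charges only pairs of minimal distortion.
    have heq := (Finset.sum_eq_sum_iff_of_le hle).1
      (le_antisymm (Finset.sum_le_sum hle) (hd.trans (hge.trans hsum.ge)))
    refine exists_codesSource p d D R hQ hp (squeeze_zero (fun n => iidProb_nonneg hQ.1 _)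
      (fun n => ?_) hfeas) hI
    rw [← iidProb_fst hp]
    refine Finset.sum_le_sum fun z _ => ?_
    rcases (prod_apply_nonneg hQ.1 z).eq_or_lt with h0 | h0
    · simp [Set.indicator_apply, ← h0]
    have hz : ∑ i, (d (z i).1 (h (z i).1) : ℝ) = ∑ i, (d (z i).1 (z i).2 : ℝ) :=
      Finset.sum_congr rfl fun i _ => mul_left_cancel₀
        (Finset.prod_ne_zero_iff.1 h0.ne' i (Finset.mem_univ i)) (heq (z i) (Finset.mem_univ _))
    simp [Set.indicator_apply, hz]

end

/-! ### Random packing -/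

section

variable {U V I O : Type*} [Fintype U]

theorem sum_iid_mul_eval (P : PMF U) (M : ℕ) (m : Fin M) (u : U → ℝ≥0∞) :
    ∑ C, iid P M C * u (C m) = ∑ a, P a * u a := by
  have h1 : ∑ a, P a = 1 := by rw [← tsum_fintype (L := .unconditional U)]; exact P.tsum_coe
  have h := sum_prod_apply (fun (i : Fin M) a => P a * (if i = m then u a else 1))
  rw [Finset.prod_eq_single m (fun i _ hi => by simp [hi, h1]) (by simp)] at h
  simp only [Finset.prod_mul_distrib, if_true] at h
  rw [← h]
  refine Finset.sum_congr rfl fun C _ => ?_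
  rw [iid_apply, Finset.prod_ite_eq' Finset.univ m fun i => u (C i)]
  simp

theorem sum_iid_mul_eval_mul_eval (P : PMF U) (M : ℕ) {m m' : Fin M} (hm : m ≠ m')
    (u v : U → ℝ≥0∞) :
    ∑ C, iid P M C * (u (C m) * v (C m')) = (∑ a, P a * u a) * ∑ a, P a * v a := by
  have h1 : ∑ a, P a = 1 := by rw [← tsum_fintype (L := .unconditional U)]; exact P.tsum_coe
  have h := sum_prod_apply
    (fun (i : Fin M) a => P a * ((if i = m then u a else 1) * (if i = m' then v a else 1)))
  rw [Finset.prod_eq_mul m m' hm (fun i _ hi => by simp [hi.1, hi.2, h1]) (by simp) (by simp)] at h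
  simp only [Finset.prod_mul_distrib, if_true, hm, hm.symm, if_false, mul_one, one_mul] at h
  rw [← h]
  refine Finset.sum_congr rfl fun C _ => ?_
  rw [iid_apply, Finset.prod_ite_eq' Finset.univ m fun i => u (C i),
    Finset.prod_ite_eq' Finset.univ m' fun i => v (C i)]
  simp

theorem iid_map_eval (P : PMF U) (M : ℕ) (m : Fin M) : (iid P M).map (fun C => C m) = P := by
  classical
  ext a
  rw [PMF.map_apply, tsum_fintype]
  have h := sum_iid_mul_eval P M m fun b => if a = b then 1 else 0
  simpa using h

open scoped Classical in
/-- The random channel code obtained from the code `c` for the source `P`: the messages are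
represented by independent source sequences, and the decoder looks for the unique message whose
sequence is compatible, in the sense of `G`, with the reconstruction. -/
def packingCode (c : RandomCode U I O V) (P : PMF U) (M : ℕ) (G : Set (U × V)) :
    RandomCode (Fin M) I O (Option (Fin M)) :=
  (iid P M).bind fun C => c.map fun ef =>
    (fun m => ef.1 (C m),
      fun o => if h : ∃! m, (C m, ef.2 o) ∈ G then some h.choose else none)

/-- A single codeword is distributed as the source block, so every fixed message uses the channel
exactly as the source did. -/
theorem inputLaw_packingCode (c : RandomCode U I O V) (P : PMF U) (M : ℕ) (G : Set (U × V))
    (m : Fin M) : inputLaw (packingCode c P M G) (PMF.pure m) = inputLaw c P := by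
  rw [inputLaw, PMF.pure_bind, packingCode, PMF.map_bind, inputLaw]
  simp only [PMF.map_comp]
  conv_rhs => rw [← iid_map_eval P M m, PMF.bind_map]
  rfl

theorem jointLaw_endToEnd_toOuterMeasure (c : RandomCode U I O V) (P : PMF U) (k : I → PMF O)
    (s : Set (U × V)) :
    (jointLaw P (endToEnd c k)).toOuterMeasure s =
      ∑ u, P u * ∑' ef, c ef * (k (ef.1 u)).toOuterMeasure {o | (u, ef.2 o) ∈ s} := by
  rw [jointLaw, toOuterMeasure_bind_fintype]
  refine Finset.sum_congr rfl fun u _ => ?_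
  rw [PMF.toOuterMeasure_map_apply, endToEnd, PMF.toOuterMeasure_bind_apply]
  simp_rw [PMF.toOuterMeasure_map_apply]
  rfl

/-- A codeword independent of the transmitted one is compatible with the reconstruction with
probability at most `β`. -/
theorem sum_iid_confusion_le (c : RandomCode U I O V) (P : PMF U) {M : ℕ} {m m' : Fin M}
    (hm : m ≠ m') (G : Set (U × V)) (k : I → PMF O) {β : ℝ≥0∞}
    (hβ : ∀ v, P.toOuterMeasure {u | (u, v) ∈ G} ≤ β) :
    ∑ C, iid P M C * ∑' ef, c ef * (k (ef.1 (C m))).toOuterMeasure {o | (C m', ef.2 o) ∈ G} ≤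
      β := by
  classical
  have hP1 : ∑ a, P a = 1 := by rw [← tsum_fintype (L := .unconditional U)]; exact P.tsum_coe
  have hexpand : ∀ C : Fin M → U, iid P M C *
      ∑' ef, c ef * (k (ef.1 (C m))).toOuterMeasure {o | (C m', ef.2 o) ∈ G} =
      ∑' ef, ∑' o, c ef * (iid P M C * (k (ef.1 (C m)) o *
        {u | (u, ef.2 o) ∈ G}.indicator 1 (C m'))) := by
    intro C
    simp_rw [← ENNReal.tsum_mul_left, PMF.toOuterMeasure_apply]
    refine tsum_congr fun ef => ?_
    simp_rw [← ENNReal.tsum_mul_left]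
    refine tsum_congr fun o => ?_
    by_cases h : (C m', ef.2 o) ∈ G
    · rw [Set.indicator_of_mem (by exact h), Set.indicator_of_mem (by exact h), Pi.one_apply]
      ring
    · rw [Set.indicator_of_notMem (by exact h), Set.indicator_of_notMem (by exact h)]
      ring
  simp_rw [hexpand]
  -- For a fixed deterministic pair and channel output, the average over codebooks factorizes: the
  -- output depends only on the codeword of `m`, the compatibility test only on that of `m'`.
  have hswap : ∑ C, ∑' ef, ∑' o, c ef * (iid P M C * (k (ef.1 (C m)) o *
      {u | (u, ef.2 o) ∈ G}.indicator 1 (C m'))) =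
      ∑' ef, ∑' o, c ef * ((∑ a, P a * k (ef.1 a) o) *
        ∑ a, P a * {u | (u, ef.2 o) ∈ G}.indicator 1 a) := by
    rw [← Summable.tsum_finsetSum fun _ _ => ENNReal.summable]
    refine tsum_congr fun ef => ?_
    rw [← Summable.tsum_finsetSum fun _ _ => ENNReal.summable]
    refine tsum_congr fun o => ?_
    rw [← Finset.mul_sum, sum_iid_mul_eval_mul_eval P M hm fun u => k (ef.1 u) o]
  rw [hswap]
  have hind : ∀ v, ∑ a, P a * {u | (u, v) ∈ G}.indicator 1 a ≤ β := fun v => by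
    refine le_trans (le_of_eq ?_) (hβ v)
    rw [PMF.toOuterMeasure_apply_fintype]
    exact Finset.sum_congr rfl fun a _ => by simp [Set.indicator_apply]
  calc ∑' ef, ∑' o, c ef * ((∑ a, P a * k (ef.1 a) o) *
        ∑ a, P a * {u | (u, ef.2 o) ∈ G}.indicator 1 a)
      ≤ ∑' ef, ∑' o, c ef * ((∑ a, P a * k (ef.1 a) o) * β) :=
        ENNReal.tsum_le_tsum fun ef => ENNReal.tsum_le_tsum fun o => by gcongr; exact hind _
    _ = β := by
        simp_rw [ENNReal.tsum_mul_left, ENNReal.tsum_mul_right]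
        simp_rw [Summable.tsum_finsetSum fun _ _ => ENNReal.summable, ENNReal.tsum_mul_left,
          PMF.tsum_coe, mul_one, hP1, one_mul, ENNReal.tsum_mul_right, PMF.tsum_coe, one_mul]

/-- Union bound: decoding is correct if the true codeword is compatible with the reconstruction and
no other one is. -/
theorem packingCode_error_le (c : RandomCode U I O V) (P : PMF U) (M : ℕ) (G : Set (U × V))
    (k : I → PMF O) {β : ℝ≥0∞} (hβ : ∀ v, P.toOuterMeasure {u | (u, v) ∈ G} ≤ β) (m : Fin M) :
    (endToEnd (packingCode c P M G) k m).toOuterMeasure {some m}ᶜ ≤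
      (jointLaw P (endToEnd c k)).toOuterMeasure Gᶜ + M * β := by
  classical
  have hpt : ∀ (C : Fin M → U) (ef : (U → I) × (O → V)),
      (k (ef.1 (C m))).toOuterMeasure
        {o | (if h : ∃! m, (C m, ef.2 o) ∈ G then some h.choose else none) ≠ some m} ≤
      (k (ef.1 (C m))).toOuterMeasure {o | (C m, ef.2 o) ∈ Gᶜ} +
        ∑ m' ∈ Finset.univ.erase m,
          (k (ef.1 (C m))).toOuterMeasure {o | (C m', ef.2 o) ∈ G} := by
    intro C ef
    refine (MeasureTheory.measure_mono (t := {o | (C m, ef.2 o) ∈ Gᶜ} ∪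
      ⋃ m' ∈ Finset.univ.erase m, {o | (C m', ef.2 o) ∈ G}) fun o ho => ?_).trans
      ((MeasureTheory.measure_union_le _ _).trans
        (add_le_add le_rfl (MeasureTheory.measure_biUnion_finset_le _ _)))
    by_contra hcon
    simp only [Set.mem_union, Set.mem_iUnion, not_or, not_exists, Finset.mem_erase,
      Set.mem_ofPred_eq, Set.mem_compl_iff, not_not] at hcon
    have hu : ∃! m, (C m, ef.2 o) ∈ G := ⟨m, hcon.1, fun m' hm' => by
      by_contra hne
      exact hcon.2 m' ⟨hne, Finset.mem_univ _⟩ hm'⟩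
    refine ho ?_
    rw [dif_pos hu]
    exact congrArg some (hu.unique hu.choose_spec.1 hcon.1)
  have hL : (endToEnd (packingCode c P M G) k m).toOuterMeasure {some m}ᶜ =
      ∑ C, iid P M C * ∑' ef, c ef * (k (ef.1 (C m))).toOuterMeasure
        {o | (if h : ∃! m, (C m, ef.2 o) ∈ G then some h.choose else none) ≠ some m} := by
    rw [endToEnd, packingCode, PMF.bind_bind, toOuterMeasure_bind_fintype]
    refine Finset.sum_congr rfl fun C _ => ?_
    rw [PMF.bind_map, PMF.toOuterMeasure_bind_apply]
    simp only [Function.comp, PMF.toOuterMeasure_map_apply]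
    rfl
  rw [hL, jointLaw_endToEnd_toOuterMeasure]
  calc _ ≤ ∑ C, iid P M C * ∑' ef, c ef *
          ((k (ef.1 (C m))).toOuterMeasure {o | (C m, ef.2 o) ∈ Gᶜ} +
        ∑ m' ∈ Finset.univ.erase m,
          (k (ef.1 (C m))).toOuterMeasure {o | (C m', ef.2 o) ∈ G}) := by
        refine Finset.sum_le_sum fun C _ => ?_
        gcongr with ef
        exact hpt C ef
    _ = (∑ C, iid P M C * ∑' ef, c ef *
          (k (ef.1 (C m))).toOuterMeasure {o | (C m, ef.2 o) ∈ Gᶜ}) +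
        ∑ m' ∈ Finset.univ.erase m, ∑ C, iid P M C * ∑' ef, c ef *
          (k (ef.1 (C m))).toOuterMeasure {o | (C m', ef.2 o) ∈ G} := by
        rw [Finset.sum_comm, ← Finset.sum_add_distrib]
        refine Finset.sum_congr rfl fun C _ => ?_
        rw [← Finset.mul_sum, ← mul_add,
          ← Summable.tsum_finsetSum fun _ _ => ENNReal.summable, ← ENNReal.tsum_add]
        simp_rw [mul_add, Finset.mul_sum]
    _ ≤ _ := by
        refine add_le_add (le_of_eq ?_) ?_
        · exact sum_iid_mul_eval P M m fun u =>
            ∑' ef, c ef * (k (ef.1 u)).toOuterMeasure {o | (u, ef.2 o) ∈ Gᶜ}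
        · refine (Finset.sum_le_card_nsmul _ _ β fun m' hm' =>
            sum_iid_confusion_le c P (Finset.ne_of_mem_erase hm').symm G k hβ).trans ?_
          rw [nsmul_eq_mul]
          gcongr
          exact (Finset.card_le_univ _).trans (by simp)

theorem jointLaw_fst_toOuterMeasure {U V : Type*} (P : PMF U) (W : U → PMF V) (s : Set U) :
    (jointLaw P W).toOuterMeasure {w | w.1 ∈ s} = P.toOuterMeasure s := by
  have h : (jointLaw P W).map Prod.fst = P := by
    rw [jointLaw, PMF.map_bind]
    simp only [PMF.map_comp]
    have : (fun a => (W a).map (Prod.fst ∘ fun y => (a, y))) = PMF.pure := by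
      funext a
      exact PMF.map_const (W a) a
    rw [this, PMF.bind_pure]
  conv_rhs => rw [← h, PMF.toOuterMeasure_map_apply]
  rfl

end

/-! ### Channel coding from joint source-channel coding -/

section

variable {X Y I O : Type*} [Fintype X]

/-- Block length one already produces a reconstruction symbol; a best reconstruction of each source
symbol then exists. -/
theorem nonempty_of_jointCode {X Y I O : Type*} (p : PMF X) (c : JointCode X Y I O) (k : Channel I O) :
    Nonempty Y := by
  obtain ⟨x, -⟩ := p.support_nonempty
  obtain ⟨ef, -⟩ := (c 1).support_nonempty
  obtain ⟨o, -⟩ := (k 1 (ef.1 fun _ => x)).support_nonempty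
  exact ⟨ef.2 o 0⟩

theorem iidProb_min_le_excessProb (p : PMF X) (d : X → Y → ℝ≥0) (D : ℝ) {h : X → Y}
    (hmin : ∀ a b, d a (h a) ≤ d a b) {n : ℕ} (hn : 0 < n) (W : (Fin n → X) → PMF (Fin n → Y)) :
    ENNReal.ofReal (iidProb (fun a => (p a).toReal) n
      {x | n * D < ∑ i, (d (x i) (h (x i)) : ℝ)}) ≤ excessProb p d D n W := by
  rw [← iid_toOuterMeasure, ← jointLaw_fst_toOuterMeasure (iid p n) W]
  refine MeasureTheory.measure_mono fun w hw => ?_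
  refine (lt_avgDistortion_iff d D hn _ _).2 (lt_of_lt_of_le hw (Finset.sum_le_sum fun i _ => ?_))
  exact_mod_cast hmin _ _

open scoped Classical in
/-- The sequences in which no symbol occurs with frequency exceeding its probability by more than
`δ`. -/
def typicalSet (p : X → ℝ) (δ : ℝ) (n : ℕ) : Set (Fin n → X) :=
  {x | ∀ a, ∑ i, (if x i = a then 1 else 0 : ℝ) ≤ n * (p a + δ)}

theorem tendsto_iidProb_typicalSet_compl {p : X → ℝ} (hp : ∀ a, 0 ≤ p a) (h1 : ∑ a, p a = 1)
    {δ : ℝ} (hδ : 0 < δ) :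
    Tendsto (fun n => iidProb p n (typicalSet p δ n)ᶜ) atTop (𝓝 0) := by
  classical
  have hsym : ∀ a, Tendsto (fun n : ℕ => iidProb p n
      {x | n * (p a + δ) < ∑ i, (if x i = a then 1 else 0 : ℝ)}) atTop (𝓝 0) := fun a => by
    have hmean : ∑ b, p b * (if b = a then 1 else 0 : ℝ) < p a + δ := by simpa using hδ
    have h := tendsto_iidProb_sum_gt (f := fun b => if b = a then 1 else 0) hp h1 hmean
    exact h
  have hlim := tendsto_finsetSum Finset.univ fun a _ => hsym a
  rw [Finset.sum_const_zero] at hlim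
  refine squeeze_zero (fun n => iidProb_nonneg hp _) (fun n => ?_) hlim
  refine (iidProb_mono hp fun x hx => ?_).trans (iidProb_iUnion_le hp _)
  simpa [typicalSet] using hx

variable [Fintype Y]

theorem jointType_mem_of_typical {p : X → ℝ} {δ : ℝ} {n : ℕ} (hn : 0 < n) {x : Fin n → X}
    (hx : x ∈ typicalSet p δ n) (y : Fin n → Y) :
    jointType x y ∈ stdSimplex ℝ (X × Y) ∧ ∀ a, ∑ b, jointType x y (a, b) ≤ p a + δ := by
  classical
  refine ⟨⟨jointType_nonneg x y, sum_jointType hn x y⟩, fun a => ?_⟩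
  have h := mul_sum_jointType_mul x y fun z => if z.1 = a then 1 else 0
  have h' : ∑ z : X × Y, jointType x y z * (if z.1 = a then 1 else 0) =
      ∑ b, jointType x y (a, b) := by
    rw [Fintype.sum_prod_type_right]
    exact Finset.sum_congr rfl fun b _ => by simp
  rw [h'] at h
  have hxa := hx a
  have hn' : (0 : ℝ) < n := by positivity
  refine le_of_mul_le_mul_left ?_ hn'
  rw [h]
  convert hxa

/-- Contrapositive of achievability: less information would yield a source code of rate `R`, below
the infimum. -/
theorem le_jointInfo_of_lt_rateDistortion (p : PMF X) (d : X → Y → ℝ≥0) (D : ℝ) {R : ℝ≥0}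
    (hR : (R : ℝ≥0∞) < rateDistortion p d D) {h : X → Y} (hmin : ∀ a b, d a (h a) ≤ d a b)
    (hfeas : Tendsto (fun n : ℕ => iidProb (fun a => (p a).toReal) n
      {x | n * D < ∑ i, (d (x i) (h (x i)) : ℝ)}) atTop (𝓝 0))
    {Q : X × Y → ℝ} (hQ : Q ∈ stdSimplex ℝ (X × Y)) (hp : ∀ a, ∑ b, Q (a, b) = (p a).toReal)
    (hd : ∑ z, Q z * (d z.1 z.2 : ℝ) ≤ D) :
    R * Real.log 2 ≤ jointInfo (fun a => (p a).toReal) Q := by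
  by_contra! hlt
  have hs := exists_codesSource_of_mean_le p d D R hmin hfeas hQ hp hd hlt
  exact absurd hR (not_lt.2 (iInf₂_le R hs))

/-- Below the rate-distortion function, typical source sequences within distortion `D` of a given
reconstruction are exponentially rare. -/
theorem exists_packing_exponent (p : PMF X) (d : X → Y → ℝ≥0) (D : ℝ) {R : ℝ≥0}
    (hR : (R : ℝ≥0∞) < rateDistortion p d D) {h : X → Y} (hmin : ∀ a b, d a (h a) ≤ d a b)
    (hfeas : Tendsto (fun n : ℕ => iidProb (fun a => (p a).toReal) n
      {x | n * D < ∑ i, (d (x i) (h (x i)) : ℝ)}) atTop (𝓝 0)) :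
    ∃ δ > 0, ∃ ρ > R * Real.log 2, ∀ n (y : Fin n → Y), iidProb (fun a => (p a).toReal) n
      {x | x ∈ typicalSet (fun a => (p a).toReal) δ n ∧ avgDistortion d x y ≤ D} ≤
      ((n : ℝ) + 1) ^ Fintype.card (X × Y) * Real.exp (-(n * ρ)) := by
  -- The information bound at `R₁` is not strict, whereas the compactness lemma needs a strict one
  -- and packing needs an exponent strictly above `R * log 2`; `R₁` leaves room for both.
  obtain ⟨R₁, hRR₁, hR₁⟩ := ENNReal.lt_iff_exists_nnreal_btwn.1 hR
  have hlog : (R : ℝ) * Real.log 2 < R₁ * Real.log 2 :=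
    mul_lt_mul_of_pos_right (by exact_mod_cast hRR₁) (Real.log_pos one_lt_two)
  obtain ⟨ρ, hRρ, hρ⟩ := exists_between hlog
  obtain ⟨δ, hδ, hslack⟩ := exists_marginal_slack (sum_toReal p)
    (fun z : X × Y => (d z.1 z.2 : ℝ)) D ρ fun Q hQ hp hd =>
      hρ.trans_le (le_jointInfo_of_lt_rateDistortion p d D hR₁ hmin hfeas hQ hp hd)
  refine ⟨δ, hδ, ρ, hRρ, fun n y => ?_⟩
  have hp0 : ∀ a, 0 ≤ (p a).toReal := fun _ => ENNReal.toReal_nonneg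
  rcases Nat.eq_zero_or_pos n with rfl | hn
  · refine (iidProb_mono hp0 (Set.subset_univ _)).trans ?_
    rw [iidProb_univ (sum_toReal p)]
    simp
  refine iidProb_le_of_jointInfo_ge hp0 y fun x hx _ => ?_
  obtain ⟨hmem, hmarg⟩ := jointType_mem_of_typical hn hx.1 y
  refine (hslack _ hmem hmarg ?_).le
  have hn' : (0 : ℝ) < n := by positivity
  refine le_of_mul_le_mul_left ?_ hn'
  rw [mul_sum_jointType_mul x y fun z => (d z.1 z.2 : ℝ)]
  exact not_lt.1 fun hlt => absurd ((lt_avgDistortion_iff d D hn x y).2 hlt) (not_lt.2 hx.2)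

theorem tendsto_add_one_pow_mul_exp_neg (k : ℕ) {ε : ℝ} (hε : 0 < ε) :
    Tendsto (fun n : ℕ => ((n : ℝ) + 1) ^ k * Real.exp (-(n * ε))) atTop (𝓝 0) := by
  have h := (tendsto_rpow_mul_exp_neg_mul_atTop_nhds_zero k ε hε).comp
    (tendsto_natCast_atTop_atTop.comp (tendsto_add_atTop_nat 1))
  have h2 := h.mul_const (Real.exp ε)
  rw [zero_mul] at h2
  refine h2.congr fun n => ?_
  simp only [Function.comp, Nat.cast_add, Nat.cast_one, Real.rpow_natCast]
  rw [mul_assoc, ← Real.exp_add]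
  congr 2
  ring

theorem exists_channelCode {A : Set (Channel I O)} (p : PMF X) (d : X → Y → ℝ≥0) (D : ℝ)
    {c : JointCode X Y I O} (hc : Communicates A p d D c) {R : ℝ≥0}
    (hR : (R : ℝ≥0∞) < rateDistortion p d D) :
    ∃ c' : ChannelCode R I O, IsReliable A c' ∧
      ∀ n (m : Message R n), inputLaw (c' n) (PMF.pure m) = inputLaw (c n) (iid p n) := by
  -- Over an empty compound channel reliability is vacuous and only the input law matters, so any
  -- compatibility set serves. Otherwise one member `k₀` certifies that distortion `D` is
  -- attainable, which gives `hfeas`.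
  rcases A.eq_empty_or_nonempty with rfl | ⟨k₀, hk₀⟩
  · exact ⟨fun n => packingCode (c n) (iid p n) _ ∅, ⟨0, tendsto_const_nhds, by simp⟩,
      fun n m => inputLaw_packingCode ..⟩
  obtain ⟨ω, hω, hcω⟩ := hc
  have : Nonempty Y := nonempty_of_jointCode p c k₀
  have hexm : ∀ a, ∃ b, ∀ b', d a b ≤ d a b' := fun a => Finite.exists_min (d a)
  choose h hmin using hexm
  have hp0 : ∀ a, 0 ≤ (p a).toReal := fun _ => ENNReal.toReal_nonneg
  have hfeas : Tendsto (fun n : ℕ => iidProb (fun a => (p a).toReal) n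
      {x | n * D < ∑ i, (d (x i) (h (x i)) : ℝ)}) atTop (𝓝 0) := by
    have hω' : Tendsto (fun n => (ω n : ℝ)) atTop (𝓝 0) := by
      simpa using NNReal.tendsto_coe.2 hω
    refine tendsto_of_tendsto_of_tendsto_of_le_of_le' tendsto_const_nhds hω'
      (Eventually.of_forall fun n => iidProb_nonneg hp0 _) ?_
    filter_upwards [eventually_gt_atTop 0] with n hn
    have := (iidProb_min_le_excessProb p d D hmin hn _).trans (hcω k₀ hk₀ n)
    rw [← ENNReal.ofReal_coe_nnreal] at this
    exact (ENNReal.ofReal_le_ofReal_iff (ω n).2).1 this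
  obtain ⟨δ, hδ, ρ, hρ, hpack⟩ := exists_packing_exponent p d D hR hmin hfeas
  let T : ∀ n, Set (Fin n → X) := typicalSet (fun a => (p a).toReal) δ
  let β : ℕ → ℝ := fun n => ((n : ℝ) + 1) ^ Fintype.card (X × Y) * Real.exp (-(n * ρ))
  let G : ∀ n, Set ((Fin n → X) × (Fin n → Y)) :=
    fun n => {w | w.1 ∈ T n ∧ avgDistortion d w.1 w.2 ≤ D}
  have hG : ∀ n v, (iid p n).toOuterMeasure {u | (u, v) ∈ G n} ≤ ENNReal.ofReal (β n) :=
    fun n v => by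
      rw [iid_toOuterMeasure]
      exact ENNReal.ofReal_le_ofReal (hpack n v)
  let r : ℕ → ℝ := fun n => iidProb (fun a => (p a).toReal) n (T n)ᶜ +
    ((2 ^ ⌊(n : ℝ≥0) * R⌋₊ : ℕ) : ℝ) * β n
  have hr : Tendsto r atTop (𝓝 0) := by
    have h2 := tendsto_add_one_pow_mul_exp_neg (Fintype.card (X × Y)) (sub_pos.2 hρ)
    have h3 : Tendsto (fun n : ℕ => ((2 ^ ⌊(n : ℝ≥0) * R⌋₊ : ℕ) : ℝ) * β n) atTop (𝓝 0) := by
      refine squeeze_zero (fun n => by positivity) (fun n => ?_) h2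
      calc ((2 ^ ⌊(n : ℝ≥0) * R⌋₊ : ℕ) : ℝ) * β n
          ≤ Real.exp (n * (R * Real.log 2)) * β n :=
            mul_le_mul_of_nonneg_right (two_pow_floor_le R n) (by positivity)
        _ = _ := by
            rw [mul_left_comm, ← Real.exp_add]
            congr 2
            ring
    have h4 := (tendsto_iidProb_typicalSet_compl hp0 (sum_toReal p) hδ).add h3
    rwa [add_zero] at h4
  refine ⟨fun n => packingCode (c n) (iid p n) _ (G n), ⟨fun n => ω n + (r n).toNNReal, ?_, ?_⟩,
    fun n m => inputLaw_packingCode ..⟩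
  · have := hω.add (tendsto_real_toNNReal hr)
    simpa using this
  · intro k hk n
    refine iSup_le fun m => (packingCode_error_le (c n) (iid p n) _ (G n) (k n) (hG n) m).trans ?_
    -- Incompatibility means excess distortion, bounded by `ω`, or an atypical source block, whose
    -- probability does not involve the channel.
    have hGc : (jointLaw (iid p n) (endToEnd (c n) (k n))).toOuterMeasure (G n)ᶜ ≤
        ω n + ENNReal.ofReal (iidProb (fun a => (p a).toReal) n (T n)ᶜ) := by
      rw [← iid_toOuterMeasure, ← jointLaw_fst_toOuterMeasure (iid p n) (endToEnd (c n) (k n))]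
      refine le_trans ((MeasureTheory.measure_mono fun w hw => ?_).trans
        (MeasureTheory.measure_union_le _ _)) (add_le_add_left (hcω k hk n) _)
      by_cases hT : w.1 ∈ T n
      · exact Or.inl (not_le.1 fun hle => hw ⟨hT, hle⟩)
      · exact Or.inr hT
    refine (add_le_add_left hGc _).trans (le_of_eq ?_)
    rw [ENNReal.coe_add, add_assoc]
    congr 1
    rw [← ENNReal.ofReal_natCast, ← ENNReal.ofReal_mul (by positivity),
      ← ENNReal.ofReal_add (iidProb_nonneg hp0 _) (by positivity)]
    rfl

end

/-! ### Source codes with uniform messages -/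

section

variable {U V : Type*}

/-- The source code `s`, with its messages embedded into a larger set and shifted by a common
uniformly distributed amount. -/
def shiftedCode {M M' : ℕ} [NeZero M] [NeZero M'] (h : M ≤ M')
    (s : RandomCode U (Fin M) (Fin M) V) : RandomCode U (Fin M') (Fin M') V :=
  s.bind fun ef => (PMF.uniformOfFintype (Fin M')).map fun u =>
    (fun x => Fin.castLE h (ef.1 x) + u, fun m => ef.2 (Fin.ofNat M (m - u).val))

/-- The decoder subtracts the shift and recovers the embedded message, on which the reduction modulo
`M` is the identity. -/
theorem endToEnd_shiftedCode {M M' : ℕ} [NeZero M] [NeZero M'] (h : M ≤ M')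
    (s : RandomCode U (Fin M) (Fin M) V) (x : U) :
    endToEnd (shiftedCode h s) PMF.pure x = endToEnd s PMF.pure x := by
  rw [endToEnd, shiftedCode, PMF.bind_bind, endToEnd]
  congr 1
  funext ef
  rw [PMF.bind_map, PMF.pure_map]
  have : ((fun ef : (U → Fin M') × (Fin M' → V) => (PMF.pure (ef.1 x)).map ef.2) ∘ fun u =>
      (fun x => Fin.castLE h (ef.1 x) + u, fun m => ef.2 (Fin.ofNat M (m - u).val))) =
      fun _ => PMF.pure (ef.2 (ef.1 x)) := by
    funext u
    simp [PMF.pure_map]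
  rw [this, PMF.bind_const]

theorem uniformOfFintype_map_add_left {M : ℕ} [NeZero M] (a : Fin M) :
    (PMF.uniformOfFintype (Fin M)).map (fun u => a + u) = PMF.uniformOfFintype (Fin M) := by
  ext b
  rw [PMF.map_apply, tsum_eq_single (b - a)]
  · simp
  · intro u hu
    rw [if_neg]
    rintro rfl
    simp at hu

/-- As with a one-time pad, adding a uniform shift gives a uniform message whatever the source
block. -/
theorem shiftedCode_map_encode {M M' : ℕ} [NeZero M] [NeZero M'] (h : M ≤ M')
    (s : RandomCode U (Fin M) (Fin M) V) (x : U) :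
    (shiftedCode h s).map (fun ef => ef.1 x) = PMF.uniformOfFintype (Fin M') := by
  rw [shiftedCode, PMF.map_bind]
  have : (fun ef : (U → Fin M) × (Fin M → V) => ((PMF.uniformOfFintype (Fin M')).map fun u =>
      ((fun x => Fin.castLE h (ef.1 x) + u : U → Fin M'),
        (fun m => ef.2 (Fin.ofNat M (m - u).val) : Fin M' → V))).map fun ef => ef.1 x) =
      fun _ => PMF.uniformOfFintype (Fin M') := by
    funext ef
    rw [PMF.map_comp]
    exact uniformOfFintype_map_add_left _
  rw [this, PMF.bind_const]

end

/-! ### Separation -/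

section

variable {X Y I O : Type*}

theorem toOuterMeasure_le_one {V : Type*} (P : PMF V) (s : Set V) : P.toOuterMeasure s ≤ 1 := by
  rw [PMF.toOuterMeasure_apply, ← P.tsum_coe]
  exact ENNReal.tsum_le_tsum fun v => Set.indicator_le_self' (fun _ _ => zero_le) v

theorem inputLaw_separationCode {R : ℝ≥0} (s : SourceCode R X Y) (c : ChannelCode R I O) (n : ℕ)
    (hs : ∀ x, (s n).map (fun ef => ef.1 x) = PMF.uniformOfFintype (Message R n))
    (P : PMF (Fin n → X)) :
    inputLaw (separationCode s c n) P =
      inputLaw (c n) (PMF.uniformOfFintype (Message R n)) := by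
  rw [inputLaw]
  have : (fun x => (separationCode s c n).map fun ef => ef.1 x) =
      fun _ => inputLaw (c n) (PMF.uniformOfFintype (Message R n)) := by
    funext x
    rw [separationCode, PMF.map_bind, inputLaw, ← hs x, PMF.bind_map]
    simp only [PMF.map_comp]
    rfl
  rw [this, PMF.bind_const]

/-- Condition on the source block and the source code. If they already exceed the distortion, bound
by `1`; otherwise an excess forces a channel decoding error. Maximal error is what is needed, since
the message sent is not uniform for a fixed source code. -/
theorem excessProb_separationCode_le [Fintype X] {R : ℝ≥0} (p : PMF X) (d : X → Y → ℝ≥0) (D : ℝ)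
    (s : SourceCode R X Y) (c : ChannelCode R I O) (n : ℕ) (k : (Fin n → I) → PMF (Fin n → O))
    {δ : ℝ≥0∞} (hδ : ∀ m, (endToEnd (c n) k m).toOuterMeasure {some m}ᶜ ≤ δ) :
    excessProb p d D n (endToEnd (separationCode s c n) k) ≤
      excessProb p d D n (endToEnd (s n) PMF.pure) + δ := by
  have hP1 : ∑ x, iid p n x = 1 := by
    rw [← tsum_fintype (L := .unconditional (Fin n → X))]; exact (iid p n).tsum_coe
  have hstep : ∀ (x : Fin n → X) (es : ((Fin n → X) → Message R n) × (Message R n → Fin n → Y)),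
      ∑' ec, c n ec * (k (ec.1 (es.1 x))).toOuterMeasure
        {o | D < avgDistortion d x (es.2 ((ec.2 o).getD 0))} ≤
      (PMF.pure (es.1 x)).toOuterMeasure {m | D < avgDistortion d x (es.2 m)} + δ := by
    intro x es
    by_cases hx : D < avgDistortion d x (es.2 (es.1 x))
    · have h1 : (PMF.pure (es.1 x)).toOuterMeasure {m | D < avgDistortion d x (es.2 m)} = 1 := by
        rw [PMF.toOuterMeasure_pure_apply, if_pos (by exact hx)]
      rw [h1]
      refine le_trans ?_ le_self_add
      calc _ ≤ ∑' ec, c n ec * 1 := by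
            gcongr
            exact toOuterMeasure_le_one _ _
        _ = 1 := by simp_rw [mul_one]; exact (c n).tsum_coe
    · refine le_trans ?_ le_add_self
      refine le_trans ?_ (hδ (es.1 x))
      rw [endToEnd, PMF.toOuterMeasure_bind_apply]
      gcongr with ec
      rw [PMF.toOuterMeasure_map_apply]
      refine MeasureTheory.measure_mono fun o ho hsome => hx ?_
      have ho' : D < avgDistortion d x (es.2 ((ec.2 o).getD 0)) := ho
      rw [show ec.2 o = some (es.1 x) from hsome] at ho'
      exact ho'
  rw [excessProb_eq_sum, excessProb_eq_sum]
  have hx : ∀ x, (endToEnd (separationCode s c n) k x).toOuterMeasure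
      {y | D < avgDistortion d x y} ≤
      (endToEnd (s n) PMF.pure x).toOuterMeasure {y | D < avgDistortion d x y} + δ := by
    intro x
    rw [endToEnd, separationCode, PMF.bind_bind, PMF.toOuterMeasure_bind_apply, endToEnd,
      PMF.toOuterMeasure_bind_apply]
    calc _ ≤ ∑' es, s n es * ((PMF.pure (es.1 x)).toOuterMeasure
          {m | D < avgDistortion d x (es.2 m)} + δ) := by
          gcongr with es
          rw [PMF.bind_map, PMF.toOuterMeasure_bind_apply]
          simp only [Function.comp, PMF.toOuterMeasure_map_apply]
          exact hstep x es
      _ = _ := by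
          simp_rw [mul_add, ENNReal.tsum_add, ENNReal.tsum_mul_right, PMF.tsum_coe, one_mul,
            PMF.toOuterMeasure_map_apply]
          rfl
  calc _ ≤ ∑ x, iid p n x *
        ((endToEnd (s n) PMF.pure x).toOuterMeasure {y | D < avgDistortion d x y} + δ) := by
        gcongr with x
        exact hx x
    _ = _ := by
        simp_rw [mul_add, Finset.sum_add_distrib]
        rw [← Finset.sum_mul, hP1, one_mul]

theorem excessProb_ne_top [Fintype X] (p : PMF X) (d : X → Y → ℝ≥0) (D : ℝ) (n : ℕ)
    (W : (Fin n → X) → PMF (Fin n → Y)) : excessProb p d D n W ≠ ∞ :=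
  ((toOuterMeasure_le_one _ _).trans_lt ENNReal.one_lt_top).ne

theorem communicates_separationCode [Fintype X] {A : Set (Channel I O)} {R : ℝ≥0} {p : PMF X}
    {d : X → Y → ℝ≥0} {D : ℝ} {s : SourceCode R X Y} (hs : CodesSource p d D s)
    {c : ChannelCode R I O} (hc : IsReliable A c) : Communicates A p d D (separationCode s c) := by
  obtain ⟨δ, hδ, hcδ⟩ := hc
  refine ⟨fun n => (excessProb p d D n (endToEnd (s n) PMF.pure)).toNNReal + δ n, ?_, ?_⟩
  · have h := (ENNReal.tendsto_toNNReal ENNReal.zero_ne_top).comp hs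
    simpa using h.add hδ
  · intro k hk n
    rw [ENNReal.coe_add, ENNReal.coe_toNNReal (excessProb_ne_top p d D n _)]
    exact excessProb_separationCode_le p d D s c n (k n) fun m =>
      (le_iSup (fun m => (endToEnd (c n) (k n) m).toOuterMeasure {some m}ᶜ) m).trans (hcδ k hk n)

/-- The infimum provides a code of some rate `R' < R`; its smaller message set embeds into that of
rate `R`, where the shift makes messages uniform. -/
theorem exists_codesSource_uniform [Fintype X] (p : PMF X) (d : X → Y → ℝ≥0) (D : ℝ) {R : ℝ≥0}
    (hR : rateDistortion p d D < (R : ℝ≥0∞)) :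
    ∃ s : SourceCode R X Y, CodesSource p d D s ∧
      ∀ n x, (s n).map (fun ef => ef.1 x) = PMF.uniformOfFintype (Message R n) := by
  simp only [rateDistortion, iInf_lt_iff] at hR
  obtain ⟨R', ⟨s, hs⟩, hR'⟩ := hR
  have hRR : R' ≤ R := by exact_mod_cast hR'.le
  have hM : ∀ n : ℕ, 2 ^ ⌊(n : ℝ≥0) * R'⌋₊ ≤ 2 ^ ⌊(n : ℝ≥0) * R⌋₊ := fun n =>
    Nat.pow_le_pow_right two_pos (Nat.floor_le_floor (by gcongr))
  refine ⟨fun n => shiftedCode (hM n) (s n), ?_, fun n x => shiftedCode_map_encode (hM n) (s n) x⟩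
  refine hs.congr fun n => ?_
  rw [show endToEnd (shiftedCode (hM n) (s n)) PMF.pure = endToEnd (s n) PMF.pure from
    funext fun x => endToEnd_shiftedCode (hM n) (s n) x]

end

end Separation

end

open Separation in
theorem theorem1 {X Y I O : Type*} [Fintype X] [Fintype Y] [Fintype I] [Fintype O]
    (p : PMF X) (d : X → Y → ℝ≥0) (D : ℝ) :
    (∀ (A : Set (Channel I O)) (c : JointCode X Y I O), Communicates A p d D c →
      ∀ R : ℝ≥0, (R : ℝ≥0∞) < rateDistortion p d D →
        ∃ c' : ChannelCode R I O, IsReliable A c' ∧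
          ∀ n (m : Message R n), inputLaw (c' n) (PMF.pure m) = inputLaw (c n) (iid p n)) ∧
    (∀ R : ℝ≥0, rateDistortion p d D < (R : ℝ≥0∞) →
      ∃ s : SourceCode R X Y, CodesSource p d D s ∧
        ∀ (A : Set (Channel I O)) (c : ChannelCode R I O), IsReliable A c →
          Communicates A p d D (separationCode s c) ∧
          ∀ n, inputLaw (separationCode s c n) (iid p n) =
            inputLaw (c n) (PMF.uniformOfFintype (Message R n))) := by
  refine ⟨fun A c hc R hR => exists_channelCode p d D hc hR, fun R hR => ?_⟩
  obtain ⟨s, hs, hunif⟩ := exists_codesSource_uniform p d D hR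
  exact ⟨s, hs, fun A c hc => ⟨communicates_separationCode hs hc,
    fun n => inputLaw_separationCode s c n (hunif n) (iid p n)⟩⟩
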